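/- **Catalan tuples and tables.** A Catalan tuple of length $k\ge 0$ is a tuple $\tilde e=(e_0,\dots,e_k)$ of non-negative integers with $\sum_{j=0}^k e_j=k$ and $\sum_{j=0}^l e_j>l$ for $l=0,\dots,k-1$; write $|\tilde e|=k$. A Catalan table of length $k$ is a tuple $T=\langle\tilde e^{(0)},\dots,\tilde e^{(k)}\rangle$ of Catalan tuples whose length tuple $(1+|\tilde e^{(0)}|,|\tilde e^{(1)}|,\dots,|\tilde e^{(k)}|)$ is a Catalan tuple of length $k$; $\mathcal T_k$ is the (finite) set of these tables. **Trees.** For a Catalan tuple $(e_0,\dots,e_k)$ draw vertices $0,\dots,k$ on a line and process them from left to right. *Direct tree* (also *pocket tree*): connect vertex $l$ (unless $l=0$) to the last vertex $m<l$ with an open half-edge, then attach $e_l$ open half-edges to $l$. *Opposite tree*: if $e_l>0$, attach $e_l$ open half-edges to $l$; if $e_l=0$, connect $l$ to the last vertex $m<l$ with an open half-edge, and repeat this until the last vertex with an open half-edge is one to which $l$ is connected (or no half-edge is open). Edges of direct and opposite trees ("threads") are oriented from left to right. **Monomials.** Let $T\in\mathcal T_{k+1}$, $N=2k+2$. Draw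 the pocket tree of the length tuple of $T$, with root $P_0$ and vertices $P_0,\dots,P_{k+1}$ numbered in counterclockwise order, and label its $N$ edge sides consecutively $p_0,\dots,p_{N-1}$, starting from the root and turning counterclockwise around the tree. Each edge with side labels $p_i,p_j$, $i<j$, gives a factor $G_{p_ip_j}$. For each vertex $P_m$, list the edges attached to it, beginning with the one closest to the root and proceeding counterclockwise; their side labels with even index form one row of nodes, those with odd index another, in this order of the edges. If $P_m$ has even distance from $P_0$, draw the direct tree of $\tilde e^{(m)}$ on the even row and the opposite tree of $\tilde e^{(m)}$ on the odd row; if the distance is odd, draw the opposite tree on the even row and the direct tree on the odd row. A thread from $p_i$ to $p_j$ gives a factor $\frac1{E_{p_i}-E_{p_j}}$. The product of all these factors is $[T]_{p_0\dots p_{N-1}}$. **Theorem 4.4.** Let $E_p$ be elements of a field, indexed by the elements $p$ of a set $I$, and consider families $G$ assigning to every word $p_0\dots p_{N-1}$ in $I$ an element $G_{p_0\dots p_{N-1}}$ of the field. Call a word admissible if $E_{p_i}\ne E_{p_j}$ whenever $i\neq j$ have the same parity. Then $G$ satisfies the recurrence for the planar $N$-point functions of the quartic matrix field theory model (with coupling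 constant $\lambda=-1$), $$G_{p_0\dots p_{N-1}}=\sum_{l=1}^{\frac{N-2}2}\frac{G_{p_0\dots p_{2l-1}}\,G_{p_{2l}\dots p_{N-1}}-G_{p_1\dots p_{2l}}\,G_{p_0p_{2l+1}\dots p_{N-1}}}{(E_{p_0}-E_{p_{2l}})(E_{p_1}-E_{p_{N-1}})}$$ for all admissible words of even length $N\ge4$, if and only if $$G_{p_0\dots p_{N-1}}=\sum_{T\in\mathcal T_{N/2}}[T]_{p_0\dots p_{N-1}}$$ for all admissible words of even length $N\ge 2$. Moreover, the terms of this sum correspond bijectively to the Catalan tables of length $N/2$: two Catalan tables of the same length $k+1\geq 1$ with the same multiset of factors $G_{p_ip_j}$ and the same multiset of factors $\frac{1}{E_{p_i}-E_{p_j}}$, the latter up to sign (all factors being regarded as formal symbols in the indices $i,j$), are equal. -/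

import Mathlib

/-! Tuples are lists of natural numbers; a tuple of tuples is a list of lists.  Entries, vertices and
edge-side labels are all numbered from `0`. -/

namespace QuarticModel

/-! ### Catalan tuples and Catalan tables -/

/-- `e = (e_0, …, e_k)` is a Catalan tuple: `e_0 + ⋯ + e_k = k`, and `e_0 + ⋯ + e_l > l` for all
`l = 0, …, k - 1`.  Its length `|e| = k` (one less than the number of entries) equals `e.sum`. -/
def IsCatalanTuple (e : List ℕ) : Prop :=
  e.length = e.sum + 1 ∧ ∀ l < e.sum, l < (e.take (l + 1)).sum

/-- The length tuple `(1 + |e⁽⁰⁾|, |e⁽¹⁾|, …, |e⁽ᵏ⁾|)` of `⟨e⁽⁰⁾, …, e⁽ᵏ⁾⟩`. -/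
def lengthTuple : List (List ℕ) → List ℕ
  | [] => []
  | e :: T => (1 + e.sum) :: T.map List.sum

/-- `T = ⟨e⁽⁰⁾, …, e⁽ᵏ⁾⟩` is a Catalan table of length `k`: every `e⁽ʲ⁾` is a Catalan tuple, and the
length tuple is itself a Catalan tuple of length `k`. -/
def IsCatalanTable (k : ℕ) (T : List (List ℕ)) : Prop :=
  (∀ e ∈ T, IsCatalanTuple e) ∧ T.length = k + 1 ∧ IsCatalanTuple (lengthTuple T)

/-- The set of Catalan tables of length `k`. -/
def CatalanTable (k : ℕ) : Type :=
  {T : List (List ℕ) // IsCatalanTable k T}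

theorem finite_lists {α : Type} {s : Set α} (hs : s.Finite) (n : ℕ) :
    {l : List α | l.length = n ∧ ∀ x ∈ l, x ∈ s}.Finite := by
  induction n with
  | zero =>
    refine (Set.finite_singleton ([] : List α)).subset ?_
    rintro l ⟨h, -⟩
    exact List.length_eq_zero_iff.1 h
  | succ n ih =>
    refine ((hs.prod ih).image (fun q : α × List α => q.1 :: q.2)).subset ?_
    rintro l ⟨h, hl⟩
    cases l with
    | nil => simp at h
    | cons a l =>
      refine ⟨(a, l), ⟨hl a (by simp), by simpa using h, fun x hx => hl x (by simp [hx])⟩, rfl⟩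

theorem finite_catalanTuples (k : ℕ) : {e : List ℕ | IsCatalanTuple e ∧ e.sum ≤ k}.Finite := by
  refine ((Set.finite_Iic k).biUnion
    (fun n _ => finite_lists (Set.finite_Iic k) (n + 1))).subset ?_
  rintro e ⟨h, hk⟩
  simp only [Set.mem_iUnion]
  exact ⟨e.sum, hk, h.1, fun x hx => (List.le_sum_of_mem hx).trans hk⟩

theorem finite_catalanTables (k : ℕ) : {T : List (List ℕ) | IsCatalanTable k T}.Finite := by
  refine (finite_lists (finite_catalanTuples k) (k + 1)).subset ?_
  rintro T ⟨h1, h2, h3⟩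
  refine ⟨h2, fun e he => ⟨h1 e he, ?_⟩⟩
  have hs : (lengthTuple T).sum = k := by
    have hl : (lengthTuple T).length = T.length := by cases T <;> simp [lengthTuple]
    have := h3.1
    omega
  cases T with
  | nil => simp at he
  | cons a T =>
    simp only [lengthTuple, List.sum_cons] at hs
    rcases List.mem_cons.1 he with rfl | he
    · omega
    · have : e.sum ≤ (T.map List.sum).sum := List.le_sum_of_mem (List.mem_map_of_mem he)
      omega

noncomputable instance (k : ℕ) : Fintype (CatalanTable k) :=
  (finite_catalanTables k).fintype

/-! ### Drawing algorithms for the planted plane trees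

The vertices `0, 1, 2, …` are processed from left to right.  The state of the algorithm is the list
of the vertices carrying open half-edges, the last vertex first, every vertex listed as many times as
it has open half-edges.  An edge from `m` to `l`, `m < l`, is the pair `(m, l)`. -/

/-- One pass of the direct-tree algorithm, starting at vertex `l` with the given open half-edges:
`l` is connected to the last vertex with an open half-edge (the root has none to connect to), and
then `e_l` half-edges are attached to `l`. -/
def directAux : ℕ → List ℕ → List ℕ → List (ℕ × ℕ)
  | _, _, [] => []
  | l, [], e :: es => directAux (l + 1) (List.replicate e l) es
  | l, m :: st, e :: es => (m, l) :: directAux (l + 1) (List.replicate e l ++ st) es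

/-- Edges of the direct tree (which is also the pocket tree) of a Catalan tuple, ordered by their
right end points `1, 2, …`. -/
def directTree (e : List ℕ) : List (ℕ × ℕ) :=
  directAux 0 [] e

/-- Connect `l` to the last vertex with an open half-edge, and repeat this until `l` is connected to
the vertex which then is the last one with an open half-edge (or until none is open).  Returns the
new edges and the remaining open half-edges. -/
def closeHalfEdges (l : ℕ) : List ℕ → List (ℕ × ℕ) × List ℕ
  | [] => ([], [])
  | [m] => ([(m, l)], [])
  | m :: n :: st =>
    if m = n then ([(m, l)], n :: st)
    else ((m, l) :: (closeHalfEdges l (n :: st)).1, (closeHalfEdges l (n :: st)).2)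

/-- One pass of the opposite-tree algorithm: if `e_l > 0`, then `e_l` half-edges are attached to
`l`; if `e_l = 0`, then `l` is connected to previous vertices by `closeHalfEdges`. -/
def oppositeAux : ℕ → List ℕ → List ℕ → List (ℕ × ℕ)
  | _, _, [] => []
  | l, st, 0 :: es => (closeHalfEdges l st).1 ++ oppositeAux (l + 1) (closeHalfEdges l st).2 es
  | l, st, (e + 1) :: es => oppositeAux (l + 1) (List.replicate (e + 1) l ++ st) es

/-- Edges of the opposite tree of a Catalan tuple. -/
def oppositeTree (e : List ℕ) : List (ℕ × ℕ) :=
  oppositeAux 0 [] e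

/-! ### The pocket tree of a Catalan table and the labels of its edge sides

The pockets (vertices) `P_0, P_1, …` of the pocket tree are numbered in counterclockwise order, with
root `P_0`.  The edge of the tree that joins `P_c`, `c ≥ 1`, to its parent is referred to as the
edge `c`. -/

/-- Edges of the pocket tree of `T`, as pairs (parent, child). -/
def pocketTree (T : List (List ℕ)) : List (ℕ × ℕ) :=
  directTree (lengthTuple T)

/-- The walk around a tree, counterclockwise: given the path from the current vertex back to the
root (both included) and the edges still to be discovered, list the edges in the order in which their
sides are passed.  To reach the next vertex `c`, with parent `m`, walk up to `m` and then down the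
edge `c`; at the very end, walk up to the root. -/
def walk : List ℕ → List (ℕ × ℕ) → List ℕ
  | path, [] => path.takeWhile (· ≠ 0)
  | path, (m, c) :: es =>
    path.takeWhile (· ≠ m) ++ c :: walk (c :: path.dropWhile (· ≠ m)) es

/-- The `i`-th entry is the edge of the pocket tree which has `p_i` as one of its two side labels. -/
def edgeSides (T : List (List ℕ)) : List ℕ :=
  walk [0] (pocketTree T)

/-- The smaller side label of the edge `c`. -/
def firstSide (T : List (List ℕ)) (c : ℕ) : ℕ :=
  (edgeSides T).idxOf c

/-- The larger side label of the edge `c`. -/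
def secondSide (T : List (List ℕ)) (c : ℕ) : ℕ :=
  (edgeSides T).length - 1 - (edgeSides T).reverse.idxOf c

/-- The even one of the two side labels of the edge `c`. -/
def evenSide (T : List (List ℕ)) (c : ℕ) : ℕ :=
  if Even (firstSide T c) then firstSide T c else secondSide T c

/-- The odd one of the two side labels of the edge `c`. -/
def oddSide (T : List (List ℕ)) (c : ℕ) : ℕ :=
  if Even (firstSide T c) then secondSide T c else firstSide T c

/-- The list of the distances `L_0, L_1, …` of the pockets to the root `P_0`: the root has distance
`0` and every other pocket is one step further away than its parent. -/
def levels (T : List (List ℕ)) : List ℕ :=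
  (pocketTree T).foldl (fun L a => L ++ [L.getD a.1 0 + 1]) [0]

/-- The edges attached to `P_m`, beginning with the one closest to the root, counterclockwise. -/
def incidentEdges (T : List (List ℕ)) (m : ℕ) : List ℕ :=
  ((pocketTree T).filter (fun a => a.1 = m ∨ a.2 = m)).map Prod.snd

/-- Place the nodes of a tree on a row of labels. -/
def labelThreads (row : List ℕ) (tree : List (ℕ × ℕ)) : List (ℕ × ℕ) :=
  tree.map (fun a => (row.getD a.1 0, row.getD a.2 0))

/-- The oriented threads drawn in the pocket `P_m`, as pairs of labels.  At even distance from the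
root the even nodes carry the direct tree and the odd nodes the opposite tree of the `m`-th Catalan
tuple; at odd distance it is the other way round.  (A leaf carries the tuple `(0)`, hence no
thread.) -/
def pocketThreads (T : List (List ℕ)) (m : ℕ) : List (ℕ × ℕ) :=
  let e := T.getD m []
  let evenRow := (incidentEdges T m).map (evenSide T)
  let oddRow := (incidentEdges T m).map (oddSide T)
  if Even ((levels T).getD m 0) then
    labelThreads evenRow (directTree e) ++ labelThreads oddRow (oppositeTree e)
  else
    labelThreads evenRow (oppositeTree e) ++ labelThreads oddRow (directTree e)

namespace CatalanTable

/-- The pairs `(i, j)`, `i < j`, of side labels of the edges of the pocket tree, one for every factor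
`G_{p_i p_j}`. -/
def chords {k : ℕ} (T : CatalanTable k) : List (ℕ × ℕ) :=
  (pocketTree T.1).map (fun a => (firstSide T.1 a.2, secondSide T.1 a.2))

/-- The threads `(i, j)` of all pockets, one for every factor `1 / (E_{p_i} - E_{p_j})`. -/
def threads {k : ℕ} (T : CatalanTable k) : List (ℕ × ℕ) :=
  (List.range T.1.length).flatMap (pocketThreads T.1)

/-- The monomial `[T]_{p_0 … p_{N-1}}` built from energies `E` and a 2-point function `G₂`. -/
def monomial {ι K : Type*} [Field K] (E : ι → K) (G₂ : ι → ι → K) (p : ℕ → ι) {k : ℕ}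
    (T : CatalanTable k) : K :=
  (T.chords.map (fun c => G₂ (p c.1) (p c.2))).prod *
    (T.threads.map (fun t => 1 / (E (p t.1) - E (p t.2)))).prod

end CatalanTable

/-! ### The recurrence for the planar correlation functions -/

/-- The word `p_a p_{a+1} … p_{b-1}`. -/
def word {ι : Type*} (p : ℕ → ι) (a b : ℕ) : List ι :=
  (List.Ico a b).map p

/-- Among `p_0, …, p_{N-1}`, labels in different positions of the same parity have different
energies.  These are the only energy differences that ever occur in a denominator. -/
def EnergiesDistinct {ι K : Type*} (E : ι → K) (p : ℕ → ι) (N : ℕ) : Prop :=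
  ∀ i < N, ∀ j < N, i % 2 = j % 2 → i ≠ j → E (p i) ≠ E (p j)

/-- The recurrence (at coupling constant `λ = -1`) for the planar `N`-point functions
`G_{p_0 … p_{N-1}}`, with `N = 2 k + 2 ≥ 4`; `G w` is the function attached to the word `w`. -/
def SatisfiesRecurrence {ι K : Type*} [Field K] (E : ι → K) (G : List ι → K) : Prop :=
  ∀ (k : ℕ) (p : ℕ → ι), 1 ≤ k → EnergiesDistinct E p (2 * k + 2) →
    G (word p 0 (2 * k + 2)) =
      ∑ l ∈ Finset.Icc 1 k,
        (G (word p 0 (2 * l)) * G (word p (2 * l) (2 * k + 2)) -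
            G (word p 1 (2 * l + 1)) * G (p 0 :: word p (2 * l + 1) (2 * k + 2))) /
          ((E (p 0) - E (p (2 * l))) * (E (p 1) - E (p (2 * k + 1))))

end QuarticModel

/-! Everything rests on two products of Catalan tables, `diamond` and `spade`. In `diamond S T` the
pocket trees are glued at their roots, `S` first; in `spade S T` the root of `S` is glued to the
vertex `P_1` of `T`, in front of the children already there. Uniqueness of the decomposition of
forests makes both products injective. A table has a `diamond` decomposition if its zeroth tuple is
not `(0)`, and a `spade` decomposition if its first tuple is not `(0)`. Only `[[0], [0]]` has
neither. Many tables have both.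

Let `N` be the number of labels, `a` the length of `S`, and `j` the label paired with `0` by a
chord. `diamond S T` puts `S` on the labels `0, …, 2a-1` and `T` on the remaining ones. `spade S T`
puts `S` on `1, …, 2a` and `T` on `0, 2a+1, …, N-1`. Chords and threads of the factors are
inherited, and exactly two threads are new: `(0, 2a)` and `(j, N-1)` for `diamond`, `(0, 2a)` and
`(j, 1)` for `spade` (`diamond_threads`, `spade_threads`). This rests on how direct and opposite
trees decompose under `circ` and `bullet`: the new edge at the root goes to the first node of the
added tuple in the direct tree, and to its last node in the opposite tree.

For the recurrence, write `E_1 - E_{N-1}` as `(E_j - E_{N-1}) - (E_j - E_1)` and multiply each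
monomial by it. The first difference vanishes unless the table is a `diamond` product, where it
cancels the thread `(j, N-1)`; the second vanishes unless the table is a `spade` product, where it
cancels `(j, 1)`. Summing over all tables gives the two halves of the recurrence (`totalWeight_eq`),
and strong induction on the length gives the equivalence.

For injectivity, `j` is read off from the chords and decides which decomposition to use. The number
`a` is extremal among the `c ≥ 1` for which `0` and `2c` are joined: largest for `diamond`, smallest
for `spade`. The factors occupy disjoint sets of labels, so their chords and threads can be
separated, and induction applies (`eq_of_chords_of_threads`). -/

namespace QuarticModel

/-! ### Catalan forests -/

/-- `es` is the sequence of numbers of half-edges of a forest that uses up exactly `n` half-edges. -/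
def IsForest : ℕ → List ℕ → Prop
  | n, [] => n = 0
  | 0, _ :: _ => False
  | n + 1, c :: es => IsForest (n + c) es

theorem isForest_zero {es : List ℕ} : IsForest 0 es ↔ es = [] := by
  cases es <;> simp [IsForest]

theorem isForest_succ {n : ℕ} {es : List ℕ} :
    IsForest (n + 1) es ↔ ∃ c r, es = c :: r ∧ IsForest (n + c) r := by
  cases es with
  | nil => simp [IsForest]
  | cons c r =>
    simp only [IsForest]
    constructor
    · intro h
      exact ⟨c, r, rfl, h⟩
    · rintro ⟨c, r, h, h'⟩
      cases h
      exact h'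

theorem IsForest.length_eq {n : ℕ} {es : List ℕ} (h : IsForest n es) :
    es.length = n + es.sum := by
  induction es generalizing n with
  | nil => simp [IsForest] at h; simp [h]
  | cons c r ih =>
    cases n with
    | zero => exact h.elim
    | succ n =>
      have := ih (n := n + c) h
      simp only [List.length_cons, List.sum_cons]
      omega

/-- After `l` vertices, `n + e_0 + ⋯ + e_{l-1} - l` half-edges are open. This number must be
positive before each vertex and zero at the end. -/
theorem isForest_iff {n : ℕ} {es : List ℕ} :
    IsForest n es ↔ es.length = n + es.sum ∧ ∀ l < es.length, l < n + (es.take l).sum := by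
  induction es generalizing n with
  | nil => simp [IsForest, eq_comm]
  | cons c r ih =>
    cases n with
    | zero =>
      simp only [IsForest, false_iff]
      rintro ⟨-, h⟩
      simpa using h 0 (by simp)
    | succ n =>
      simp only [IsForest]
      rw [ih]
      simp only [List.length_cons, List.sum_cons]
      constructor
      · rintro ⟨h1, h2⟩
        refine ⟨by omega, fun l hl => ?_⟩
        cases l with
        | zero => simp
        | succ l =>
          have := h2 l (by omega)
          simp only [List.take_succ_cons, List.sum_cons]
          omega
      · rintro ⟨h1, h2⟩
        refine ⟨by omega, fun l hl => ?_⟩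
        have := h2 (l + 1) (by omega)
        simp only [List.take_succ_cons, List.sum_cons] at this
        omega

theorem isCatalanTuple_cons {x : ℕ} {es : List ℕ} : IsCatalanTuple (x :: es) ↔ IsForest x es := by
  rw [isForest_iff, IsCatalanTuple]
  simp only [List.length_cons, List.sum_cons, List.take_succ_cons]
  constructor
  · rintro ⟨h1, h2⟩
    exact ⟨by omega, fun l hl => h2 l (by omega)⟩
  · rintro ⟨h1, h2⟩
    exact ⟨by omega, fun l hl => h2 l (by omega)⟩

theorem not_isCatalanTuple_nil : ¬ IsCatalanTuple [] := by
  simp [IsCatalanTuple]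

/-- Lets a whole tuple be inserted as a subtree that consumes a single half-edge. -/
theorem isForest_one {e : List ℕ} : IsForest 1 e ↔ IsCatalanTuple e := by
  cases e with
  | nil => simp [IsForest, not_isCatalanTuple_nil]
  | cons x es => simp [isCatalanTuple_cons, IsForest]

theorem IsForest.append {m n : ℕ} {as bs : List ℕ} (ha : IsForest m as) (hb : IsForest n bs) :
    IsForest (m + n) (as ++ bs) := by
  induction as generalizing m with
  | nil => simp [IsForest] at ha; simpa [ha] using hb
  | cons c r ih =>
    cases m with
    | zero => exact ha.elim
    | succ m =>
      have := ih (m := m + c) ha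
      rw [show m + 1 + n = (m + n) + 1 by omega, List.cons_append]
      simp only [IsForest]
      rwa [show m + n + c = m + c + n by omega]

theorem IsForest.exists_append {m n : ℕ} {es : List ℕ} (h : IsForest (m + n) es) :
    ∃ as bs, es = as ++ bs ∧ IsForest m as ∧ IsForest n bs := by
  induction es generalizing m with
  | nil =>
    simp [IsForest] at h
    exact ⟨[], [], by simp [IsForest, h]⟩
  | cons c r ih =>
    cases m with
    | zero => exact ⟨[], c :: r, by simp, by simp [IsForest], by simpa using h⟩
    | succ m =>
      rw [show m + 1 + n = (m + n) + 1 by omega] at h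
      simp only [IsForest] at h
      rw [show m + n + c = m + c + n by omega] at h
      obtain ⟨as, bs, rfl, h1, h2⟩ := ih h
      exact ⟨c :: as, bs, rfl, h1, h2⟩

/-- Forests on `m` half-edges form a prefix-free code: the forest ends exactly where the open
half-edges run out. Every uniqueness statement for the products comes from this. -/
theorem IsForest.append_inj {m : ℕ} {as bs as' bs' : List ℕ} (ha : IsForest m as)
    (ha' : IsForest m as') (h : as ++ bs = as' ++ bs') : as = as' ∧ bs = bs' := by
  induction as generalizing m as' with
  | nil =>
    simp only [IsForest] at ha
    subst ha
    rw [isForest_zero] at ha'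
    subst ha'
    simpa using h
  | cons c r ih =>
    cases m with
    | zero => exact ha.elim
    | succ m =>
      obtain ⟨c', r', rfl, h'⟩ := isForest_succ.1 ha'
      simp only [List.cons_append, List.cons.injEq] at h
      obtain ⟨rfl, h⟩ := h
      obtain ⟨h1, h2⟩ := ih ha h' h
      exact ⟨by rw [h1], h2⟩

/-! ### Products of Catalan tuples -/

/-- `(e_0, …, e_k) ∘ f = (e_0 + 1, e_1, …, e_k, f_0, …, f_l)`. -/
def circ (e f : List ℕ) : List ℕ := (e.headD 0 + 1) :: (e.tail ++ f)

/-- `(e_0, …, e_k) • f = (e_0 + 1, f_0, …, f_l, e_1, …, e_k)`. -/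
def bullet (e f : List ℕ) : List ℕ := (e.headD 0 + 1) :: (f ++ e.tail)

theorem IsCatalanTuple.exists_cons {e : List ℕ} (h : IsCatalanTuple e) :
    ∃ x es, e = x :: es ∧ IsForest x es := by
  cases e with
  | nil => exact (not_isCatalanTuple_nil h).elim
  | cons x es => exact ⟨x, es, rfl, isCatalanTuple_cons.1 h⟩

theorem IsCatalanTuple.circ {e f : List ℕ} (he : IsCatalanTuple e) (hf : IsCatalanTuple f) :
    IsCatalanTuple (circ e f) := by
  obtain ⟨x, es, rfl, h⟩ := he.exists_cons
  exact isCatalanTuple_cons.2 (h.append (isForest_one.2 hf))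

theorem IsCatalanTuple.bullet {e f : List ℕ} (he : IsCatalanTuple e) (hf : IsCatalanTuple f) :
    IsCatalanTuple (bullet e f) := by
  obtain ⟨x, es, rfl, h⟩ := he.exists_cons
  refine isCatalanTuple_cons.2 ?_
  have := (isForest_one.2 hf).append h
  rwa [add_comm] at this

/-- `circ` attaches a new last subtree to the root, `bullet` a new first one. A root with a child
therefore admits both splittings. -/
theorem IsCatalanTuple.exists_circ {e : List ℕ} (h : IsCatalanTuple e) (h0 : e ≠ [0]) :
    ∃ f g, e = QuarticModel.circ f g ∧ IsCatalanTuple f ∧ IsCatalanTuple g := by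
  obtain ⟨x, es, rfl, h'⟩ := h.exists_cons
  clear h
  rename IsForest x es => h
  cases x with
  | zero => rw [isForest_zero] at h; simp [h] at h0
  | succ x =>
    obtain ⟨as, bs, rfl, h1, h2⟩ := h.exists_append
    exact ⟨x :: as, bs, rfl, isCatalanTuple_cons.2 h1, isForest_one.1 h2⟩

theorem IsCatalanTuple.exists_bullet {e : List ℕ} (h : IsCatalanTuple e) (h0 : e ≠ [0]) :
    ∃ f g, e = QuarticModel.bullet f g ∧ IsCatalanTuple f ∧ IsCatalanTuple g := by
  obtain ⟨x, es, rfl, h'⟩ := h.exists_cons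
  clear h
  rename IsForest x es => h
  cases x with
  | zero => rw [isForest_zero] at h; simp [h] at h0
  | succ x =>
    rw [add_comm] at h
    obtain ⟨as, bs, rfl, h1, h2⟩ := h.exists_append
    exact ⟨x :: bs, as, rfl, isCatalanTuple_cons.2 h2, isForest_one.1 h1⟩

theorem circ_inj {e f e' f' : List ℕ} (he : IsCatalanTuple e) (he' : IsCatalanTuple e')
    (h : circ e f = circ e' f') : e = e' ∧ f = f' := by
  obtain ⟨x, es, rfl, h1⟩ := he.exists_cons
  obtain ⟨x', es', rfl, h1'⟩ := he'.exists_cons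
  simp only [circ, List.headD_cons, List.tail_cons, List.cons.injEq, Nat.add_right_cancel_iff] at h
  obtain ⟨rfl, h⟩ := h
  obtain ⟨rfl, rfl⟩ := h1.append_inj h1' h
  exact ⟨rfl, rfl⟩

theorem bullet_inj {e f e' f' : List ℕ} (he : IsCatalanTuple e) (he' : IsCatalanTuple e')
    (hf : IsCatalanTuple f) (hf' : IsCatalanTuple f')
    (h : bullet e f = bullet e' f') : e = e' ∧ f = f' := by
  obtain ⟨x, es, rfl, h1⟩ := he.exists_cons
  obtain ⟨x', es', rfl, h1'⟩ := he'.exists_cons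
  simp only [bullet, List.headD_cons, List.tail_cons, List.cons.injEq,
    Nat.add_right_cancel_iff] at h
  obtain ⟨rfl, h⟩ := h
  obtain ⟨rfl, rfl⟩ := (isForest_one.2 hf).append_inj (isForest_one.2 hf') h
  exact ⟨rfl, rfl⟩

theorem IsCatalanTuple.length_eq {e : List ℕ} (he : IsCatalanTuple e) :
    e.length = e.sum + 1 := he.1

theorem IsCatalanTuple.sum_circ {e f : List ℕ} (he : IsCatalanTuple e) :
    (QuarticModel.circ e f).sum = e.sum + f.sum + 1 := by
  obtain ⟨x, es, rfl, -⟩ := he.exists_cons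
  simp [QuarticModel.circ]
  omega

theorem IsCatalanTuple.sum_bullet {e f : List ℕ} (he : IsCatalanTuple e) :
    (QuarticModel.bullet e f).sum = e.sum + f.sum + 1 := by
  obtain ⟨x, es, rfl, -⟩ := he.exists_cons
  simp [QuarticModel.bullet]
  omega

/-! ### Direct trees -/

/-- A forest that uses up the first open half-edges is drawn before the rest, and independently. -/
theorem directAux_append {as bs : List ℕ} {L : ℕ} {st₁ st₂ : List ℕ}
    (h : IsForest st₁.length as) :
    directAux L (st₁ ++ st₂) (as ++ bs) =
      directAux L st₁ as ++ directAux (L + as.length) st₂ bs := by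
  induction as generalizing L st₁ with
  | nil =>
    simp [IsForest] at h
    subst h
    simp [directAux]
  | cons c r ih =>
    cases st₁ with
    | nil => exact h.elim
    | cons m st =>
      have h' : IsForest (List.replicate c L ++ st).length r := by
        simp only [List.length_append, List.length_replicate]
        rw [add_comm]
        exact h
      have := ih (L := L + 1) h'
      simp only [List.cons_append, directAux, List.length_cons]
      rw [List.append_assoc] at this
      rw [this, show L + 1 + r.length = L + (r.length + 1) by omega]

/-- The direct-tree algorithm never compares vertices, so `ψ` need not be injective, in contrast to
`oppositeAux_map`. -/
theorem directAux_map {as : List ℕ} {L L' : ℕ} {st : List ℕ} (ψ : ℕ → ℕ)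
    (hψ : ∀ i < as.length, ψ (L + i) = L' + i) :
    directAux L' (st.map ψ) as = (directAux L st as).map (Prod.map ψ ψ) := by
  induction as generalizing L L' st with
  | nil => simp [directAux]
  | cons c r ih =>
    have h0 : ψ L = L' := by simpa using hψ 0 (by simp)
    have h1 : ∀ i < r.length, ψ (L + 1 + i) = L' + 1 + i := by
      intro i hi
      have := hψ (i + 1) (by simp; omega)
      rw [show L + 1 + i = L + (i + 1) by omega, this]
      omega
    cases st with
    | nil =>
      have := ih (st := List.replicate c L) h1
      simpa [directAux, h0] using this
    | cons m st =>
      have := ih (st := List.replicate c L ++ st) h1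
      simpa [directAux, h0] using this

theorem directAux_snd {as : List ℕ} {L : ℕ} {st : List ℕ} (h : IsForest st.length as) :
    (directAux L st as).map Prod.snd = List.range' L as.length := by
  induction as generalizing L st with
  | nil => simp [directAux]
  | cons c r ih =>
    cases st with
    | nil => exact h.elim
    | cons m st =>
      have h' : IsForest (List.replicate c L ++ st).length r := by
        simp only [List.length_append, List.length_replicate]
        rw [add_comm]
        exact h
      simp [directAux, ih h', List.range'_succ]

theorem directAux_lt {as : List ℕ} {L : ℕ} {st : List ℕ} (h : IsForest st.length as)
    (hst : ∀ v ∈ st, v < L) :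
    ∀ a ∈ directAux L st as, a.1 < a.2 ∧ L ≤ a.2 ∧ a.2 < L + as.length := by
  induction as generalizing L st with
  | nil => simp [directAux]
  | cons c r ih =>
    cases st with
    | nil => exact h.elim
    | cons m st =>
      have h' : IsForest (List.replicate c L ++ st).length r := by
        simp only [List.length_append, List.length_replicate]
        rw [add_comm]
        exact h
      have := ih (L := L + 1) h' (by
        intro v hv
        rw [List.mem_append, List.mem_replicate] at hv
        rcases hv with ⟨-, rfl⟩ | hv
        · omega
        · have := hst v (by simp [hv])
          omega)
      simp only [directAux, List.mem_cons, List.length_cons]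
      rintro a (rfl | ha)
      · have := hst m (by simp)
        simp
        omega
      · have := this a ha
        omega

theorem directTree_cons {x : ℕ} {es : List ℕ} :
    directTree (x :: es) = directAux 1 (List.replicate x 0) es := by
  simp [directTree, directAux]

theorem directTree_lt {e : List ℕ} (he : IsCatalanTuple e) :
    ∀ a ∈ directTree e, a.1 < a.2 ∧ 1 ≤ a.2 ∧ a.2 < e.length := by
  obtain ⟨x, es, rfl, h⟩ := he.exists_cons
  intro a ha
  rw [directTree_cons] at ha
  have := directAux_lt (by simpa using h) (by simp [List.mem_replicate]) a ha
  simp only [List.length_cons]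
  omega

theorem directTree_snd {e : List ℕ} (he : IsCatalanTuple e) :
    (directTree e).map Prod.snd = List.range' 1 e.sum := by
  obtain ⟨x, es, rfl, h⟩ := he.exists_cons
  rw [directTree_cons, directAux_snd (by simpa using h), h.length_eq]
  simp

/-- The map that shifts all numbers but `0, …, c - 1`. -/
def shiftFrom (c d v : ℕ) : ℕ := if v < c then v else v + d

theorem shiftFrom_of_lt {c d v : ℕ} (h : v < c) : shiftFrom c d v = v := if_pos h

theorem shiftFrom_of_le {c d v : ℕ} (h : c ≤ v) : shiftFrom c d v = v + d := if_neg (by omega)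

theorem shiftFrom_injective (c d : ℕ) : Function.Injective (shiftFrom c d) := by
  intro v w h
  unfold shiftFrom at h
  split_ifs at h <;> omega

/-- The forest of `e` uses all but one of the root's half-edges. The last one is taken by the first
vertex of `f`, whose descendants follow. -/
theorem directTree_circ {e f : List ℕ} (he : IsCatalanTuple e) (hf : IsCatalanTuple f) :
    directTree (circ e f) = directTree e ++ (0, e.length) ::
      (directTree f).map (Prod.map (· + e.length) (· + e.length)) := by
  obtain ⟨x, es, rfl, h⟩ := he.exists_cons
  obtain ⟨y, fs, rfl, h'⟩ := hf.exists_cons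
  simp only [circ, List.headD_cons, List.tail_cons, directTree_cons]
  rw [List.replicate_add, directAux_append (by simpa using h), List.replicate_one, directAux,
    List.append_nil, add_comm 1, List.length_cons,
    ← directAux_map (L := 1) (L' := es.length + 1 + 1)]
  · simp
  · intro i _
    omega

theorem directTree_bullet {e f : List ℕ} (he : IsCatalanTuple e) (hf : IsCatalanTuple f) :
    directTree (bullet e f) = (0, 1) :: (directTree f).map (Prod.map (· + 1) (· + 1)) ++
      (directTree e).map (Prod.map (shiftFrom 1 f.length) (shiftFrom 1 f.length)) := by
  obtain ⟨x, es, rfl, h⟩ := he.exists_cons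
  have hf' := isForest_one.2 hf
  obtain ⟨y, fs, rfl, h'⟩ := hf.exists_cons
  simp only [bullet, List.headD_cons, List.tail_cons, directTree_cons]
  rw [add_comm x, List.replicate_add, directAux_append (by simpa using hf'), List.replicate_one,
    directAux, List.append_nil, List.cons_append, ← directAux_map (L := 1) (L' := 2),
    ← directAux_map (L := 1) (L' := 1 + (y :: fs).length)]
  · simp [shiftFrom]
  · intro i _
    rw [shiftFrom_of_le (by omega)]
    omega
  · intro i _
    omega

/-! ### Opposite trees -/

/-- What `closeHalfEdges` does after the first connection, which was made to `v`. -/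
def closeRest (l v : ℕ) (st : List ℕ) : List (ℕ × ℕ) × List ℕ :=
  if st.head? = some v then ([], st) else closeHalfEdges l st

theorem closeHalfEdges_cons (l v : ℕ) (st : List ℕ) :
    closeHalfEdges l (v :: st) = ((v, l) :: (closeRest l v st).1, (closeRest l v st).2) := by
  cases st with
  | nil => simp [closeHalfEdges, closeRest]
  | cons w st =>
    by_cases h : v = w
    · simp [closeHalfEdges, closeRest, h]
    · have h' : ¬ w = v := fun h' => h h'.symm
      simp [closeHalfEdges, closeRest, h, h']

theorem closeRest_of_ne {l v w : ℕ} {st : List ℕ} (h : w ≠ v) :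
    closeRest l v (w :: st) = closeHalfEdges l (w :: st) := by
  simp [closeRest, h]

theorem closeRest_self {l v : ℕ} {st : List ℕ} : closeRest l v (v :: st) = ([], v :: st) := by
  simp [closeRest]

theorem closeRest_nil {l v : ℕ} : closeRest l v [] = ([], []) := by
  simp [closeRest, closeHalfEdges]

theorem oppositeAux_zero_cons {L v : ℕ} {st es : List ℕ} :
    oppositeAux L (v :: st) (0 :: es) =
      (v, L) :: ((closeRest L v st).1 ++ oppositeAux (L + 1) (closeRest L v st).2 es) := by
  simp [oppositeAux, closeHalfEdges_cons]

/-- The last vertex of a forest is a leaf. It closes the last half-edge of `v` and then carries on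
closing in `st`, which is what `closeRest` records. Before that moment nothing below the copies of
`v` is touched. New vertices differ from everything on the stack by `hv` and `hst`, so finishing
their own half-edges always spills over to `v`. -/
theorem oppositeAux_append {y L v : ℕ} {as st es : List ℕ} (has : IsForest (y + 1) as)
    (hv : v < L) (hst : ∀ w ∈ st, w < L) :
    oppositeAux L (List.replicate (y + 1) v ++ st) (as ++ es) =
      oppositeAux L (List.replicate (y + 1) v) as ++
        ((closeRest (L + as.length - 1) v st).1 ++
          oppositeAux (L + as.length) (closeRest (L + as.length - 1) v st).2 es) := by
  induction hn : as.length using Nat.strong_induction_on generalizing y L v as st es with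
  | _ n ih =>
  subst hn
  obtain ⟨c, rest, rfl, hr⟩ := isForest_succ.1 has
  cases c with
  | zero =>
    rw [add_zero] at hr
    cases y with
    | zero =>
      rw [isForest_zero] at hr
      subst hr
      simp [oppositeAux_zero_cons, oppositeAux, closeHalfEdges]
    | succ y =>
      have h1 := ih rest.length (by simp) (y := y) (L := L + 1) (v := v) (as := rest) (st := st)
        (es := es) hr (by omega) (fun w hw => (hst w hw).trans (by omega)) rfl
      simp only [List.replicate_succ, List.cons_append, oppositeAux_zero_cons, closeRest_self,
        List.nil_append] at h1 ⊢
      rw [h1, show L + (0 :: rest).length = L + 1 + rest.length by simp; omega]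
  | succ c =>
    rw [add_comm] at hr
    obtain ⟨A, B, rfl, hA, hB⟩ := hr.exists_append
    have e1 : ∀ s t, oppositeAux L s (((c + 1) :: (A ++ B)) ++ t) =
        oppositeAux (L + 1) (List.replicate (c + 1) L ++ s) (A ++ (B ++ t)) := by
      intro s t
      simp [oppositeAux]
    -- Stated for all `st` and `es` because it is used twice: for the given ones, and for empty ones
    -- to recognise the same edges as the drawing of the forest alone.
    have h1 := fun (st : List ℕ) (es : List ℕ) (hst : ∀ w ∈ st, w < L) =>
      ih A.length (by simp) (y := c) (L := L + 1) (v := L) (as := A)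
        (st := List.replicate (y + 1) v ++ st) (es := B ++ es) hA (by omega) (by
          intro w hw
          rw [List.mem_append, List.mem_replicate] at hw
          rcases hw with ⟨-, rfl⟩ | hw
          · omega
          · have := hst w hw
            omega) rfl
    have h2 := h1 [] [] (by simp)
    rw [← e1, List.append_nil, List.append_nil] at h2
    rw [e1, h1 st es hst, h2]
    rw [List.replicate_succ (n := y), List.cons_append, closeRest_of_ne hv.ne, closeRest_of_ne hv.ne,
      closeHalfEdges_cons, closeHalfEdges_cons]
    cases y with
    | zero =>
      rw [isForest_zero] at hB
      subst hB
      simp [oppositeAux, closeRest_nil]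
      rw [show L + 1 + A.length = L + (A.length + 1) by omega]
    | succ y =>
      have h3 := ih B.length (by simp) (y := y) (L := L + 1 + A.length) (v := v) (as := B)
        (st := st) (es := es) hB (by omega) (fun w hw => (hst w hw).trans (by omega)) rfl
      simp only [List.replicate_succ, List.cons_append, closeRest_self] at h3 ⊢
      rw [h3]
      simp only [List.nil_append, List.append_assoc, List.cons_append, List.length_cons,
        List.length_append, add_assoc, add_comm 1,
        List.append_nil]

theorem closeHalfEdges_map {st : List ℕ} {l l' : ℕ} (ψ : ℕ → ℕ) (hψ : Function.Injective ψ)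
    (hl : ψ l = l') :
    closeHalfEdges l' (st.map ψ) =
      ((closeHalfEdges l st).1.map (Prod.map ψ ψ), (closeHalfEdges l st).2.map ψ) := by
  induction st with
  | nil => simp [closeHalfEdges]
  | cons m st ih =>
    cases st with
    | nil => simp [closeHalfEdges, hl]
    | cons n st =>
      simp only [List.map_cons] at ih
      by_cases h : m = n
      · simp [closeHalfEdges, h, hl]
      · simp [closeHalfEdges, h, hl, hψ.ne h, ih]

theorem oppositeAux_map {as : List ℕ} {L L' : ℕ} {st : List ℕ} (ψ : ℕ → ℕ)
    (hψ' : Function.Injective ψ) (hψ : ∀ i < as.length, ψ (L + i) = L' + i) :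
    oppositeAux L' (st.map ψ) as = (oppositeAux L st as).map (Prod.map ψ ψ) := by
  induction as generalizing L L' st with
  | nil => simp [oppositeAux]
  | cons c r ih =>
    have h0 : ψ L = L' := by simpa using hψ 0 (by simp)
    have h1 : ∀ i < r.length, ψ (L + 1 + i) = L' + 1 + i := by
      intro i hi
      have := hψ (i + 1) (by simp; omega)
      rw [show L + 1 + i = L + (i + 1) by omega, this]
      omega
    cases c with
    | zero =>
      simp only [oppositeAux, closeHalfEdges_map ψ hψ' h0, List.map_append]
      rw [ih h1]
    | succ c =>
      have := ih (st := List.replicate (c + 1) L ++ st) h1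
      simpa [oppositeAux, h0] using this

/-- A complete Catalan tuple, met by the opposite-tree algorithm, is drawn and then connected to the
last vertex with an open half-edge. -/
theorem oppositeAux_tuple {L v : ℕ} {st f es : List ℕ} (hf : IsCatalanTuple f)
    (hst : ∀ w ∈ v :: st, w < L) :
    oppositeAux L (v :: st) (f ++ es) =
      (oppositeTree f).map (Prod.map (· + L) (· + L)) ++ (v, L + f.sum) ::
        ((closeRest (L + f.sum) v st).1 ++
          oppositeAux (L + f.sum + 1) (closeRest (L + f.sum) v st).2 es) := by
  have hl := hf.length_eq
  obtain ⟨x, fs, rfl, h⟩ := hf.exists_cons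
  cases x with
  | zero =>
    rw [isForest_zero] at h
    subst h
    simp [oppositeAux_zero_cons, oppositeTree, oppositeAux, closeHalfEdges]
  | succ x =>
    have h1 := oppositeAux_append (L := L + 1) (v := L) (st := v :: st) (es := es) h (by omega)
      (fun w hw => (hst w hw).trans (by omega))
    have hvL : v < L := hst v (by simp)
    simp only [List.cons_append, oppositeAux, oppositeTree]
    rw [h1, closeRest_of_ne hvL.ne, closeHalfEdges_cons]
    simp only [List.length_cons] at hl
    rw [show L + 1 + fs.length = L + ((x + 1) :: fs).sum + 1 by omega, Nat.add_sub_cancel,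
      ← oppositeAux_map (L := 1) (L' := L + 1)]
    · simp
    · exact add_left_injective L
    · intro i _
      omega

/-- In the opposite tree a subtree is joined to the root by its last leaf, once its inner half-edges
are closed. Hence the new edge ends at the last vertex of `f`, not at the first. -/
theorem oppositeTree_circ {e f : List ℕ} (he : IsCatalanTuple e) (hf : IsCatalanTuple f) :
    oppositeTree (circ e f) = oppositeTree e ++
      ((oppositeTree f).map (Prod.map (· + e.length) (· + e.length)) ++
        [(0, e.length + f.sum)]) := by
  obtain ⟨x, es, rfl, h⟩ := he.exists_cons
  have h2 := oppositeAux_tuple (L := es.length + 1) (v := 0) (st := []) (es := []) hf (by simp)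
  simp only [closeRest_nil, List.append_nil, oppositeAux] at h2
  simp only [circ, List.headD_cons, List.tail_cons, oppositeTree, oppositeAux]
  cases x with
  | zero =>
    rw [isForest_zero] at h
    subst h
    simp only [oppositeAux, List.nil_append, closeHalfEdges, List.length_cons, List.length_nil] at h2 ⊢
    simpa [oppositeTree] using h2
  | succ x =>
    -- The half-edge reserved for `f` is put at the bottom of the stack. As it also belongs to the
    -- root, the last vertex of `e` stops closing there.
    rw [List.append_nil, List.replicate_succ' (n := x + 1), oppositeAux_append h (by omega) (by simp),
      closeRest_self]
    simp only [List.nil_append, List.length_cons, oppositeAux, List.append_nil]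
    rw [show 0 + 1 + es.length = es.length + 1 by omega, h2]
    rfl

theorem oppositeTree_bullet {e f : List ℕ} (he : IsCatalanTuple e) (hf : IsCatalanTuple f) :
    oppositeTree (bullet e f) = (oppositeTree f).map (Prod.map (· + 1) (· + 1)) ++
      (0, f.length) ::
        (oppositeTree e).map (Prod.map (shiftFrom 1 f.length) (shiftFrom 1 f.length)) := by
  obtain ⟨x, es, rfl, h⟩ := he.exists_cons
  simp only [bullet, List.headD_cons, List.tail_cons]
  rw [oppositeTree]
  simp only [oppositeAux, List.append_nil, List.replicate_succ]
  rw [oppositeAux_tuple hf (by simp [List.mem_replicate]), hf.length_eq]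
  have h1 : ∀ i < es.length, shiftFrom 1 (f.sum + 1) (1 + i) = 0 + 1 + f.sum + 1 + i := by
    intro i _
    rw [shiftFrom_of_le (by omega)]
    omega
  have h2 := oppositeAux_map (st := List.replicate x 0) _ (shiftFrom_injective 1 (f.sum + 1)) h1
  cases x with
  | zero =>
    rw [isForest_zero] at h
    subst h
    simp [closeRest_nil, oppositeAux, oppositeTree, closeHalfEdges, add_comm]
  | succ x =>
    rw [List.replicate_succ, closeRest_self, ← List.replicate_succ]
    simp only [List.nil_append, oppositeTree, oppositeAux, List.append_nil, Nat.zero_add]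
    rw [← h2]
    simp [shiftFrom, add_comm]

theorem oppositeTree_zero : oppositeTree [0] = [] := by
  simp [oppositeTree, oppositeAux, closeHalfEdges]

/-- Induction over Catalan tuples. -/
theorem IsCatalanTuple.induction_circ {P : List ℕ → Prop} (zero : P [0])
    (circ : ∀ e f, IsCatalanTuple e → IsCatalanTuple f → P e → P f → P (QuarticModel.circ e f))
    (e : List ℕ) (he : IsCatalanTuple e) : P e := by
  induction hn : e.sum using Nat.strong_induction_on generalizing e with
  | _ n ih =>
  by_cases h0 : e = [0]
  · rw [h0]
    exact zero
  · obtain ⟨f, g, rfl, hf, hg⟩ := he.exists_circ h0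
    have := hf.sum_circ (f := g)
    exact circ f g hf hg (ih f.sum (by omega) f hf rfl) (ih g.sum (by omega) g hg rfl)

theorem oppositeTree_lt {e : List ℕ} (he : IsCatalanTuple e) :
    ∀ a ∈ oppositeTree e, a.1 < e.length ∧ a.2 < e.length := by
  refine IsCatalanTuple.induction_circ (P := fun e =>
    ∀ a ∈ oppositeTree e, a.1 < e.length ∧ a.2 < e.length) ?_ ?_ e he
  · simp [oppositeTree_zero]
  · intro e f he hf ihe ihf a ha
    have h1 := (he.circ hf).length_eq
    rw [he.sum_circ] at h1
    have h2 := he.length_eq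
    have h3 := hf.length_eq
    simp only [oppositeTree_circ he hf, List.mem_append, List.mem_map, List.mem_singleton] at ha
    rcases ha with ha | ⟨b, hb, rfl⟩ | rfl
    · have := ihe a ha
      omega
    · have := ihf b hb
      simp only [Prod.map_fst, Prod.map_snd]
      omega
    · simp only
      omega

/-! ### Walks around trees -/

/-- The vertex to which a walk has to go up before it can go on. -/
def walkTarget : List (ℕ × ℕ) → ℕ
  | [] => 0
  | a :: _ => a.1

theorem walk_cons_of_ne {v : ℕ} {path : List ℕ} {es : List (ℕ × ℕ)} (h : walkTarget es ≠ v) :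
    walk (v :: path) es = v :: walk path es := by
  cases es with
  | nil =>
    have h' : v ≠ 0 := fun h' => h h'.symm
    simp [walk, h']
  | cons a es =>
    have h' : v ≠ a.1 := fun h' => h h'.symm
    simp [walk, h']

theorem walk_cons_self {v c : ℕ} {path : List ℕ} {es : List (ℕ × ℕ)} :
    walk (v :: path) ((v, c) :: es) = c :: walk (c :: v :: path) es := by
  simp [walk]

/-- The next edge starts at the top of the stack, so a walk returns to that vertex. -/
theorem walkTarget_directAux {L : ℕ} {st as : List ℕ} {es : List (ℕ × ℕ)}
    (h : IsForest st.length as) :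
    walkTarget (directAux L st as ++ es) = st.headD (walkTarget es) := by
  cases st with
  | nil =>
    have := isForest_zero.1 h
    subst this
    simp [directAux]
  | cons m st =>
    obtain ⟨c, r, rfl, -⟩ := isForest_succ.1 h
    simp [directAux, walkTarget]

/-- The excursion around a forest hanging from `v` returns to `v` and does not depend on what
surrounds it. The condition on `walkTarget es` forces the walk to climb out of all the new vertices
before it continues. -/
theorem walk_directAux_append {n L v : ℕ} {as r : List ℕ} {es : List (ℕ × ℕ)} (h : IsForest n as)
    (hv : v < L) (hes : walkTarget es < L) :
    walk (v :: r) (directAux L (List.replicate n v) as ++ es) =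
      walk [0] (directAux L (List.replicate n 0) as) ++ walk (v :: r) es := by
  induction hn : as.length using Nat.strong_induction_on generalizing n L v as r es with
  | _ N ih =>
  subst hn
  cases n with
  | zero =>
    rw [isForest_zero] at h
    subst h
    simp [directAux, walk]
  | succ n =>
    obtain ⟨c, rest, rfl, hr⟩ := isForest_succ.1 h
    rw [add_comm] at hr
    obtain ⟨A, B, rfl, hA, hB⟩ := hr.exists_append
    have key : ∀ (v : ℕ) (r : List ℕ) (es : List (ℕ × ℕ)), v < L → walkTarget es < L →
        walk (v :: r) (directAux L (List.replicate (n + 1) v) (c :: (A ++ B)) ++ es) =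
          L :: walk [0] (directAux (L + 1) (List.replicate c 0) A) ++
            L :: walk [0] (directAux (L + 1 + A.length) (List.replicate n 0) B) ++
              walk (v :: r) es := by
      intro v r es hv hes
      rw [List.replicate_succ, directAux, directAux_append (by simpa using hA), List.cons_append,
        walk_cons_self, List.append_assoc]
      have ht : walkTarget (directAux (L + 1 + A.length) (List.replicate n v) B ++ es) < L := by
        rw [walkTarget_directAux (by simpa using hB)]
        cases n with
        | zero => simpa using hes
        | succ n => simpa [List.replicate_succ] using hv
      rw [ih A.length (by simp) hA (by omega) (ht.trans (by omega)) rfl,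
        walk_cons_of_ne ht.ne,
        ih B.length (by simp) hB (by omega) (hes.trans (by omega)) rfl]
      simp
    have h0 := key 0 [] [] (by omega) (by simp [walkTarget]; omega)
    rw [List.append_nil] at h0
    rw [key v r es hv hes, h0]
    simp [walk]

theorem walk_map {path : List ℕ} {es : List (ℕ × ℕ)} {ψ : ℕ → ℕ} (hψ : Function.Injective ψ)
    (h0 : ψ 0 = 0) : walk (path.map ψ) (es.map (Prod.map ψ ψ)) = (walk path es).map ψ := by
  have key : ∀ m, (fun x => decide (x ≠ ψ m)) ∘ ψ = fun x => decide (x ≠ m) := by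
    intro m
    funext x
    simp [hψ.eq_iff]
  induction es generalizing path with
  | nil =>
    have := key 0
    rw [h0] at this
    rw [List.map_nil, walk, walk, List.takeWhile_map, this]
  | cons a es ih =>
    obtain ⟨m, c⟩ := a
    simp only [List.map_cons, Prod.map_apply, walk, List.map_append]
    rw [List.takeWhile_map, List.dropWhile_map, key, ← List.map_cons, ih]

/-! ### Products of Catalan tables -/

/-- `⟨e⁽⁰⁾, …⟩ ♦ ⟨f⁽⁰⁾, …⟩ = ⟨e⁽⁰⁾ ∘ f⁽⁰⁾, e⁽¹⁾, …, f⁽¹⁾, …⟩`. -/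
def diamond (S T : List (List ℕ)) : List (List ℕ) :=
  circ (S.headD []) (T.headD []) :: (S.tail ++ T.tail)

/-- `⟨e⁽⁰⁾, …⟩ ♠ ⟨f⁽⁰⁾, f⁽¹⁾, …⟩ = ⟨f⁽⁰⁾, f⁽¹⁾ • e⁽⁰⁾, e⁽¹⁾, …, f⁽²⁾, …⟩`. -/
def spade (S T : List (List ℕ)) : List (List ℕ) :=
  T.headD [] :: bullet (T.tail.headD []) (S.headD []) :: (S.tail ++ T.tail.tail)

theorem isCatalanTable_cons {k : ℕ} {e : List ℕ} {es : List (List ℕ)} :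
    IsCatalanTable k (e :: es) ↔ IsCatalanTuple e ∧ (∀ f ∈ es, IsCatalanTuple f) ∧
      es.length = k ∧ IsForest (1 + e.sum) (es.map List.sum) := by
  simp [IsCatalanTable, lengthTuple, isCatalanTuple_cons, and_assoc]

theorem IsCatalanTable.exists_cons {k : ℕ} {T : List (List ℕ)} (h : IsCatalanTable k T) :
    ∃ e es, T = e :: es ∧ IsCatalanTuple e ∧ (∀ f ∈ es, IsCatalanTuple f) ∧
      es.length = k ∧ IsForest (1 + e.sum) (es.map List.sum) := by
  cases T with
  | nil => simp [IsCatalanTable] at h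
  | cons e es => exact ⟨e, es, rfl, isCatalanTable_cons.1 h⟩

theorem IsCatalanTable.exists_cons_cons {k : ℕ} {T : List (List ℕ)} (h : IsCatalanTable k T) :
    ∃ e f es, T = e :: f :: es ∧ IsCatalanTuple e ∧ IsCatalanTuple f ∧
      (∀ f ∈ es, IsCatalanTuple f) ∧ es.length + 1 = k ∧
      IsForest (f.sum + e.sum) (es.map List.sum) := by
  obtain ⟨e, es, rfl, he, hes, hl, hf⟩ := h.exists_cons
  cases es with
  | nil => simp [IsForest] at hf
  | cons f es =>
    refine ⟨e, f, es, rfl, he, hes f (by simp), fun g hg => hes g (by simp [hg]), by simpa using hl,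
      ?_⟩
    rw [add_comm 1] at hf
    rw [add_comm]
    exact hf

theorem IsCatalanTable.pos {k : ℕ} {T : List (List ℕ)} (h : IsCatalanTable k T) : 1 ≤ k := by
  obtain ⟨e, f, es, rfl, -, -, -, h, -⟩ := h.exists_cons_cons
  omega

theorem IsCatalanTable.diamond {a b : ℕ} {S T : List (List ℕ)} (hS : IsCatalanTable a S)
    (hT : IsCatalanTable b T) : IsCatalanTable (a + b) (diamond S T) := by
  obtain ⟨e, es, rfl, he, hes, rfl, he'⟩ := hS.exists_cons
  obtain ⟨f, fs, rfl, hf, hfs, rfl, hf'⟩ := hT.exists_cons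
  refine isCatalanTable_cons.2 ⟨he.circ hf, ?_, by simp, ?_⟩
  · intro g hg
    simp only [List.tail_cons, List.mem_append] at hg
    exact hg.elim (hes g) (hfs g)
  · simp only [List.headD_cons, List.tail_cons, List.map_append]
    have := he'.append hf'
    rwa [show 1 + e.sum + (1 + f.sum) = 1 + (circ e f).sum by rw [he.sum_circ]; omega] at this

theorem IsCatalanTable.spade {a b : ℕ} {S T : List (List ℕ)} (hS : IsCatalanTable a S)
    (hT : IsCatalanTable b T) : IsCatalanTable (a + b) (spade S T) := by
  obtain ⟨e, es, rfl, he, hes, rfl, he'⟩ := hS.exists_cons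
  obtain ⟨f, g, fs, rfl, hf, hg, hfs, rfl, hf'⟩ := hT.exists_cons_cons
  refine isCatalanTable_cons.2 ⟨hf, ?_, by simp; omega, ?_⟩
  · intro g' hg'
    simp only [List.tail_cons, List.headD_cons, List.mem_append, List.mem_cons] at hg'
    rcases hg' with rfl | h | h
    · exact hg.bullet he
    · exact hes _ h
    · exact hfs _ h
  · simp only [List.headD_cons, List.tail_cons, List.map_append, List.map_cons]
    have := he'.append hf'
    rw [add_comm 1]
    simp only [IsForest]
    rwa [show 1 + e.sum + (g.sum + f.sum) = f.sum + (bullet g e).sum by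
      rw [hg.sum_bullet]; omega] at this

/-- Splitting the zeroth tuple by `circ` prescribes the root degrees of the two factors. The pocket
forest then splits accordingly, since each root has one half-edge more than the length of its tuple.
-/
theorem IsCatalanTable.exists_diamond {k : ℕ} {T : List (List ℕ)} (h : IsCatalanTable k T)
    (h0 : T.headD [] ≠ [0]) : ∃ a b S S', k = a + b ∧ T = QuarticModel.diamond S S' ∧
      IsCatalanTable a S ∧ IsCatalanTable b S' := by
  obtain ⟨e, es, rfl, he, hes, rfl, he'⟩ := h.exists_cons
  obtain ⟨f, g, rfl, hf, hg⟩ := he.exists_circ h0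
  rw [hf.sum_circ, show 1 + (f.sum + g.sum + 1) = (1 + f.sum) + (1 + g.sum) by omega] at he'
  obtain ⟨as, bs, h1, h2, h3⟩ := he'.exists_append
  obtain ⟨as, bs, rfl, rfl, rfl⟩ := List.map_eq_append_iff.1 h1
  exact ⟨as.length, bs.length, f :: as, g :: bs, by simp, rfl,
    isCatalanTable_cons.2 ⟨hf, fun x hx => hes x (by simp [hx]), rfl, h2⟩,
    isCatalanTable_cons.2 ⟨hg, fun x hx => hes x (by simp [hx]), rfl, h3⟩⟩

/-- Here the tuple of `P_1` is split by `bullet`; its first `1 + |g|` children become the children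
of the root of the left factor. -/
theorem IsCatalanTable.exists_spade {k : ℕ} {T : List (List ℕ)} (h : IsCatalanTable k T)
    (h0 : T.tail.headD [] ≠ [0]) : ∃ a b S S', k = a + b ∧ T = QuarticModel.spade S S' ∧
      IsCatalanTable a S ∧ IsCatalanTable b S' := by
  obtain ⟨e, e', es, rfl, he, he', hes, rfl, hE⟩ := h.exists_cons_cons
  obtain ⟨f, g, rfl, hf, hg⟩ := he'.exists_bullet h0
  rw [hf.sum_bullet, show f.sum + g.sum + 1 + e.sum = (1 + g.sum) + (e.sum + f.sum) by omega] at hE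
  obtain ⟨as, bs, h1, h2, h3⟩ := hE.exists_append
  obtain ⟨as, bs, rfl, rfl, rfl⟩ := List.map_eq_append_iff.1 h1
  refine ⟨as.length, bs.length + 1, g :: as, e :: f :: bs, by simp; omega, rfl,
    isCatalanTable_cons.2 ⟨hg, fun x hx => hes x (by simp [hx]), rfl, h2⟩,
    isCatalanTable_cons.2 ⟨he, ?_, rfl, ?_⟩⟩
  · intro x hx
    rcases List.mem_cons.1 hx with rfl | hx
    · exact hf
    · exact hes x (by simp [hx])
  · rw [add_comm 1]
    exact h3

theorem diamond_inj {a b a' b' : ℕ} {S T S' T' : List (List ℕ)} (hS : IsCatalanTable a S)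
    (hT : IsCatalanTable b T) (hS' : IsCatalanTable a' S') (hT' : IsCatalanTable b' T')
    (h : diamond S T = diamond S' T') : S = S' ∧ T = T' := by
  obtain ⟨e, es, rfl, he, hes, rfl, he'⟩ := hS.exists_cons
  obtain ⟨f, fs, rfl, hf, hfs, rfl, hf'⟩ := hT.exists_cons
  obtain ⟨g, gs, rfl, hg, hgs, rfl, hg'⟩ := hS'.exists_cons
  obtain ⟨j, js, rfl, hj, hjs, rfl, hj'⟩ := hT'.exists_cons
  simp only [diamond, List.headD_cons, List.tail_cons, List.cons.injEq] at h
  obtain ⟨rfl, rfl⟩ := circ_inj he hg h.1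
  -- The forest condition concerns the lengths only. The cut is located there and then transferred
  -- to the lists of tuples.
  have h2 := congrArg (List.map List.sum) h.2
  rw [List.map_append, List.map_append] at h2
  have h3 := congrArg List.length (he'.append_inj hg' h2).1
  rw [List.length_map, List.length_map] at h3
  obtain ⟨rfl, rfl⟩ := List.append_inj h.2 h3
  exact ⟨rfl, rfl⟩

theorem spade_inj {a b a' b' : ℕ} {S T S' T' : List (List ℕ)} (hS : IsCatalanTable a S)
    (hT : IsCatalanTable b T) (hS' : IsCatalanTable a' S') (hT' : IsCatalanTable b' T')
    (h : spade S T = spade S' T') : S = S' ∧ T = T' := by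
  obtain ⟨e, es, rfl, he, hes, rfl, he'⟩ := hS.exists_cons
  obtain ⟨f, f', fs, rfl, hf, hff, hfs, rfl, hf'⟩ := hT.exists_cons_cons
  obtain ⟨g, gs, rfl, hg, hgs, rfl, hg'⟩ := hS'.exists_cons
  obtain ⟨j, j', js, rfl, hj, hjj, hjs, rfl, hj'⟩ := hT'.exists_cons_cons
  simp only [spade, List.headD_cons, List.tail_cons, List.cons.injEq] at h
  obtain ⟨rfl, h1, h⟩ := h
  obtain ⟨rfl, rfl⟩ := bullet_inj hff hjj he hg h1
  have h2 := congrArg (List.map List.sum) h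
  rw [List.map_append, List.map_append] at h2
  have h3 := congrArg List.length (he'.append_inj hg' h2).1
  rw [List.length_map, List.length_map] at h3
  obtain ⟨rfl, rfl⟩ := List.append_inj h h3
  exact ⟨rfl, rfl⟩

/-- Once the edge from `P_0` to `P_1` is drawn, no open half-edge is left. -/
theorem IsCatalanTable.eq_of_headD {k : ℕ} {T : List (List ℕ)} (h : IsCatalanTable k T)
    (h0 : T.headD [] = [0]) (h1 : T.tail.headD [] = [0]) : k = 1 ∧ T = [[0], [0]] := by
  obtain ⟨e, f, es, rfl, -, -, -, hk, hF⟩ := h.exists_cons_cons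
  simp only [List.headD_cons, List.tail_cons] at h0 h1
  subst h0 h1
  have := isForest_zero.1 hF
  simp only [List.map_eq_nil_iff] at this
  subst this
  exact ⟨by simpa using hk.symm, rfl⟩

/-- Induction over Catalan tables. -/
theorem IsCatalanTable.induction_products {P : ℕ → List (List ℕ) → Prop} (one : P 1 [[0], [0]])
    (diamond : ∀ a b S T, IsCatalanTable a S → IsCatalanTable b T → P a S → P b T →
      P (a + b) (QuarticModel.diamond S T))
    (spade : ∀ a b S T, IsCatalanTable a S → IsCatalanTable b T → P a S → P b T →
      P (a + b) (QuarticModel.spade S T))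
    (k : ℕ) (T : List (List ℕ)) (h : IsCatalanTable k T) : P k T := by
  induction k using Nat.strong_induction_on generalizing T with
  | _ k ih =>
  by_cases h0 : T.headD [] = [0]
  · by_cases h1 : T.tail.headD [] = [0]
    · obtain ⟨rfl, rfl⟩ := h.eq_of_headD h0 h1
      exact one
    · obtain ⟨a, b, S, S', rfl, rfl, hS, hS'⟩ := h.exists_spade h1
      have := hS.pos
      have := hS'.pos
      exact spade a b S S' hS hS' (ih a (by omega) S hS) (ih b (by omega) S' hS')
  · obtain ⟨a, b, S, S', rfl, rfl, hS, hS'⟩ := h.exists_diamond h0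
    have := hS.pos
    have := hS'.pos
    exact diamond a b S S' hS hS' (ih a (by omega) S hS) (ih b (by omega) S' hS')

/-! ### Pocket trees and edge sides of products -/

theorem pocketTree_cons {e : List ℕ} {es : List (List ℕ)} : pocketTree (e :: es) =
    directAux 1 (List.replicate (1 + e.sum) 0) (es.map List.sum) := by
  simp [pocketTree, lengthTuple, directTree_cons]

theorem pocketTree_cons_cons {e f : List ℕ} {es : List (List ℕ)} : pocketTree (e :: f :: es) =
    (0, 1) :: directAux 2 (List.replicate f.sum 1 ++ List.replicate e.sum 0)
      (es.map List.sum) := by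
  rw [pocketTree_cons, add_comm, List.replicate_succ, List.map_cons, directAux]

theorem edgeSides_cons {e : List ℕ} {es : List (List ℕ)} : edgeSides (e :: es) =
    walk [0] (directAux 1 (List.replicate (1 + e.sum) 0) (es.map List.sum)) := by
  rw [edgeSides, pocketTree_cons]

theorem edgeSides_cons_cons {e f : List ℕ} {es : List (List ℕ)} : edgeSides (e :: f :: es) =
    1 :: walk [1, 0] (directAux 2 (List.replicate f.sum 1 ++ List.replicate e.sum 0)
      (es.map List.sum)) := by
  rw [edgeSides, pocketTree_cons_cons, walk_cons_self]

theorem shiftFrom_directAux {c d L : ℕ} {st as : List ℕ} (h : c ≤ L) :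
    directAux (L + d) (st.map (shiftFrom c d)) as =
      (directAux L st as).map (Prod.map (shiftFrom c d) (shiftFrom c d)) := by
  apply directAux_map
  intro i _
  rw [shiftFrom_of_le (by omega)]
  omega

theorem diamond_tree {a b : ℕ} {S T : List (List ℕ)} (hS : IsCatalanTable a S)
    (hT : IsCatalanTable b T) :
    pocketTree (diamond S T) = pocketTree S ++
        (pocketTree T).map (Prod.map (shiftFrom 1 a) (shiftFrom 1 a)) ∧
      edgeSides (diamond S T) = edgeSides S ++ (edgeSides T).map (shiftFrom 1 a) := by
  obtain ⟨e, es, rfl, he, hes, rfl, he'⟩ := hS.exists_cons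
  obtain ⟨f, fs, rfl, hf, hfs, rfl, hf'⟩ := hT.exists_cons
  have h0 : pocketTree (diamond (e :: es) (f :: fs)) =
      directAux 1 (List.replicate (1 + e.sum) 0) (es.map List.sum) ++
        directAux (1 + es.length) (List.replicate (1 + f.sum) 0) (fs.map List.sum) := by
    simp only [diamond, List.headD_cons, List.tail_cons, pocketTree_cons, List.map_append]
    rw [he.sum_circ, show 1 + (e.sum + f.sum + 1) = (1 + e.sum) + (1 + f.sum) by omega,
      List.replicate_add (1 + e.sum), directAux_append (by simpa using he'), List.length_map]
  have h1 := shiftFrom_directAux (c := 1) (d := es.length) (L := 1)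
    (st := List.replicate (1 + f.sum) 0) (as := fs.map List.sum) le_rfl
  rw [List.map_replicate, shiftFrom_of_lt (by omega)] at h1
  refine ⟨by rw [h0, h1, pocketTree_cons, pocketTree_cons], ?_⟩
  rw [edgeSides, h0, walk_directAux_append he' (by omega), h1, edgeSides_cons, edgeSides_cons,
    ← walk_map (shiftFrom_injective _ _) (shiftFrom_of_lt (by omega))]
  · simp [shiftFrom]
  · have := walkTarget_directAux (L := 1 + es.length) (st := List.replicate (1 + f.sum) 0)
      (es := []) (by simpa using hf')
    rw [List.append_nil] at this
    rw [this]
    simp [add_comm 1, List.replicate_succ]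

/-- Counterclockwise, the walk goes down the edge `1` of `T`, around all of `S`, and then finishes
the walk around `T`. So the vertices of `S` are shifted by one, and those of `T` from `2` on by `a`.
-/
theorem spade_tree {a b : ℕ} {S T : List (List ℕ)} (hS : IsCatalanTable a S)
    (hT : IsCatalanTable b T) :
    pocketTree T = (0, 1) :: (pocketTree T).tail ∧ edgeSides T = 1 :: (edgeSides T).tail ∧
    pocketTree (spade S T) = (0, 1) :: ((pocketTree S).map (Prod.map (· + 1) (· + 1)) ++
        (pocketTree T).tail.map (Prod.map (shiftFrom 2 a) (shiftFrom 2 a))) ∧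
      edgeSides (spade S T) = 1 :: ((edgeSides S).map (shiftFrom 1 1) ++
        (edgeSides T).tail.map (shiftFrom 2 a)) := by
  obtain ⟨e, es, rfl, he, hes, rfl, he'⟩ := hS.exists_cons
  obtain ⟨f, g, fs, rfl, hf, hg, hfs, rfl, hf'⟩ := hT.exists_cons_cons
  refine ⟨by simp [pocketTree_cons_cons], by simp [edgeSides_cons_cons], ?_⟩
  have h0 : pocketTree (spade (e :: es) (f :: g :: fs)) =
      (0, 1) :: (directAux 2 (List.replicate (1 + e.sum) 1) (es.map List.sum) ++
        directAux (2 + es.length) (List.replicate g.sum 1 ++ List.replicate f.sum 0)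
          (fs.map List.sum)) := by
    simp only [spade, List.headD_cons, List.tail_cons, pocketTree_cons_cons, List.map_append]
    rw [hg.sum_bullet, show g.sum + e.sum + 1 = (1 + e.sum) + g.sum by omega,
      List.replicate_add (1 + e.sum), List.append_assoc, directAux_append (by simpa using he'),
      List.length_map]
  have h1 := shiftFrom_directAux (c := 2) (d := es.length) (L := 2)
    (st := List.replicate g.sum 1 ++ List.replicate f.sum 0) (as := fs.map List.sum) le_rfl
  rw [List.map_append, List.map_replicate, shiftFrom_of_lt (by omega), List.map_replicate,
    shiftFrom_of_lt (by omega)] at h1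
  have h2 := directAux_map (L := 1) (L' := 2)
    (st := List.replicate (1 + e.sum) 0) (as := es.map List.sum) (· + 1) (by intro i _; omega)
  rw [List.map_replicate] at h2
  have h3 := shiftFrom_directAux (c := 1) (d := 1) (L := 1)
    (st := List.replicate (1 + e.sum) 0) (as := es.map List.sum) le_rfl
  rw [List.map_replicate, shiftFrom_of_lt (by omega)] at h3
  refine ⟨by rw [h0, h1, h2, pocketTree_cons, pocketTree_cons_cons, List.tail_cons], ?_⟩
  have hp : [1, 0] = [1, 0].map (shiftFrom 2 es.length) := by simp [shiftFrom]
  rw [edgeSides, h0, walk_cons_self, walk_directAux_append he' (by omega), h1, edgeSides_cons,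
    edgeSides_cons_cons, h3, List.tail_cons,
    ← walk_map (shiftFrom_injective _ _) (shiftFrom_of_lt (by omega)),
    ← walk_map (shiftFrom_injective _ _) (shiftFrom_of_lt (by omega)), ← hp]
  · simp [shiftFrom]
  · have := walkTarget_directAux (L := 2 + es.length)
      (st := List.replicate g.sum 1 ++ List.replicate f.sum 0) (as := fs.map List.sum)
      (es := []) (by simpa using hf')
    rw [List.append_nil] at this
    rw [this]
    rcases g.sum with _ | n <;> rcases f.sum with _ | m <;> simp [List.replicate_succ, walkTarget]

/-! ### Positions in a list -/

theorem idxOf_map_of_injective {ψ : ℕ → ℕ} (hψ : Function.Injective ψ) (l : List ℕ) (c : ℕ) :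
    (l.map ψ).idxOf (ψ c) = l.idxOf c := by
  induction l with
  | nil => simp
  | cons x l ih =>
    rw [List.map_cons]
    by_cases h : x = c
    · rw [h, List.idxOf_cons_self, List.idxOf_cons_self]
    · rw [List.idxOf_cons_ne _ h, List.idxOf_cons_ne _ (hψ.ne h), ih]

/-- The position of the last occurrence of `c`. -/
def lastIdxOf (c : ℕ) (l : List ℕ) : ℕ := l.length - 1 - l.reverse.idxOf c

theorem lastIdxOf_map {ψ : ℕ → ℕ} (hψ : Function.Injective ψ) (l : List ℕ) (c : ℕ) :
    lastIdxOf (ψ c) (l.map ψ) = lastIdxOf c l := by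
  simp only [lastIdxOf]
  rw [← List.map_reverse, idxOf_map_of_injective hψ, List.length_map]

theorem lastIdxOf_append_of_mem {c : ℕ} {A B : List ℕ} (h : c ∈ B) :
    lastIdxOf c (A ++ B) = A.length + lastIdxOf c B := by
  have h' : c ∈ B.reverse := by simpa using h
  have := List.idxOf_lt_length_of_mem h'
  rw [List.length_reverse] at this
  simp only [lastIdxOf, List.reverse_append, List.length_append]
  rw [List.idxOf_append_of_mem h']
  omega

theorem lastIdxOf_append_of_notMem {c : ℕ} {A B : List ℕ} (h : c ∉ B) :
    lastIdxOf c (A ++ B) = lastIdxOf c A := by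
  have h' : c ∉ B.reverse := by simpa using h
  simp only [lastIdxOf, List.reverse_append, List.length_append]
  rw [List.idxOf_append_of_notMem h', List.length_reverse]
  omega

theorem lastIdxOf_lt {c : ℕ} {l : List ℕ} (h : c ∈ l) : lastIdxOf c l < l.length := by
  have := List.length_pos_of_mem h
  simp only [lastIdxOf]
  omega

theorem secondSide_eq (T : List (List ℕ)) (c : ℕ) :
    secondSide T c = lastIdxOf c (edgeSides T) := rfl

/-! ### The edge sides of a Catalan table -/

theorem edgeSides_one : edgeSides [[0], [0]] = [1, 1] := by
  decide

theorem edgeSides_facts {k : ℕ} {T : List (List ℕ)} (h : IsCatalanTable k T) :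
    (edgeSides T).length = 2 * k ∧ (∀ c, c ∈ edgeSides T ↔ 1 ≤ c ∧ c ≤ k) ∧
      1 ∈ (edgeSides T).tail := by
  refine IsCatalanTable.induction_products (P := fun k T => (edgeSides T).length = 2 * k ∧
    (∀ c, c ∈ edgeSides T ↔ 1 ≤ c ∧ c ≤ k) ∧ 1 ∈ (edgeSides T).tail) ?_ ?_ ?_ k T h
  · rw [edgeSides_one]
    refine ⟨rfl, fun c => ?_, by simp⟩
    simp
    omega
  · rintro a b S T hS hT ⟨hS1, hS2, hS3⟩ ⟨hT1, hT2, hT3⟩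
    rw [(diamond_tree hS hT).2]
    refine ⟨by simp [hS1, hT1]; omega, fun c => ?_, ?_⟩
    · rw [List.mem_append, hS2, List.mem_map]
      constructor
      · rintro (hc | ⟨d, hd, rfl⟩)
        · omega
        · rw [hT2] at hd
          rw [shiftFrom_of_le hd.1]
          omega
      · intro hc
        by_cases hca : c ≤ a
        · exact Or.inl ⟨hc.1, hca⟩
        · refine Or.inr ⟨c - a, (hT2 _).2 (by omega), ?_⟩
          rw [shiftFrom_of_le] <;> omega
    · have hne : edgeSides S ≠ [] := by
        intro h0
        simp [h0] at hS3
      rw [List.tail_append_of_ne_nil hne]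
      simp [hS3]
  · rintro a b S T hS hT ⟨hS1, hS2, hS3⟩ ⟨hT1, hT2, hT3⟩
    obtain ⟨-, h1, -, h2⟩ := spade_tree hS hT
    have hb := hT.pos
    rw [h2]
    have hl : (edgeSides T).tail.length + 1 = 2 * b := by
      rw [← hT1]
      nth_rewrite 2 [h1]
      simp
    refine ⟨by simp [hS1] at hl ⊢; omega, fun c => ?_, ?_⟩
    · have hT2' : ∀ c, c ∈ (edgeSides T).tail ↔ 1 ≤ c ∧ c ≤ b := by
        intro c
        rw [← hT2]
        constructor
        · exact List.mem_of_mem_tail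
        · intro hc
          rw [h1, List.mem_cons] at hc
          rcases hc with rfl | hc
          · exact hT3
          · exact hc
      rw [List.mem_cons, List.mem_append, List.mem_map, List.mem_map]
      constructor
      · rintro (rfl | ⟨d, hd, rfl⟩ | ⟨d, hd, rfl⟩)
        · omega
        · rw [hS2] at hd
          rw [shiftFrom_of_le hd.1]
          omega
        · rw [hT2'] at hd
          unfold shiftFrom
          split_ifs <;> omega
      · rintro hc
        by_cases hc1 : c = 1
        · exact Or.inl hc1
        · by_cases hca : c ≤ a + 1
          · refine Or.inr (Or.inl ⟨c - 1, (hS2 _).2 (by omega), ?_⟩)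
            rw [shiftFrom_of_le] <;> omega
          · refine Or.inr (Or.inr ⟨c - a, (hT2' _).2 (by omega), ?_⟩)
            rw [shiftFrom_of_le] <;> omega
    · rw [List.tail_cons, List.mem_append]
      exact Or.inr (List.mem_map.2 ⟨1, hT3, shiftFrom_of_lt (by omega)⟩)

theorem edgeSides_eq_cons {k : ℕ} {T : List (List ℕ)} (h : IsCatalanTable k T) :
    edgeSides T = 1 :: (edgeSides T).tail :=
  -- Only a statement about the second factor is needed, so the table is used as both factors.
  (spade_tree h h).2.1

theorem mem_edgeSides {k c : ℕ} {T : List (List ℕ)} (h : IsCatalanTable k T) :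
    c ∈ edgeSides T ↔ 1 ≤ c ∧ c ≤ k :=
  (edgeSides_facts h).2.1 c

theorem mem_edgeSides_tail {k c : ℕ} {T : List (List ℕ)} (h : IsCatalanTable k T) :
    c ∈ (edgeSides T).tail ↔ 1 ≤ c ∧ c ≤ k := by
  rw [← mem_edgeSides h]
  constructor
  · exact List.mem_of_mem_tail
  · intro hc
    rw [edgeSides_eq_cons h, List.mem_cons] at hc
    rcases hc with rfl | hc
    · exact (edgeSides_facts h).2.2
    · exact hc

theorem firstSide_one {k : ℕ} {T : List (List ℕ)} (h : IsCatalanTable k T) : firstSide T 1 = 0 := by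
  rw [firstSide, edgeSides_eq_cons h, List.idxOf_cons_self]

theorem firstSide_eq_zero {k c : ℕ} {T : List (List ℕ)} (h : IsCatalanTable k T)
    (h0 : firstSide T c = 0) : c = 1 := by
  rw [firstSide, edgeSides_eq_cons h] at h0
  by_contra hc
  rw [List.idxOf_cons_ne _ (Ne.symm hc)] at h0
  omega

theorem firstSide_lt {k c : ℕ} {T : List (List ℕ)} (h : IsCatalanTable k T) (hc : 1 ≤ c)
    (hc' : c ≤ k) : firstSide T c < 2 * k := by
  rw [← (edgeSides_facts h).1]
  exact List.idxOf_lt_length_of_mem ((mem_edgeSides h).2 ⟨hc, hc'⟩)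

theorem secondSide_lt {k c : ℕ} {T : List (List ℕ)} (h : IsCatalanTable k T) (hc : 1 ≤ c)
    (hc' : c ≤ k) : secondSide T c < 2 * k := by
  rw [← (edgeSides_facts h).1]
  exact lastIdxOf_lt ((mem_edgeSides h).2 ⟨hc, hc'⟩)

theorem secondSide_eq_tail {k c : ℕ} {T : List (List ℕ)} (h : IsCatalanTable k T) (hc : 1 ≤ c)
    (hc' : c ≤ k) : secondSide T c = 1 + lastIdxOf c (edgeSides T).tail := by
  rw [secondSide_eq, edgeSides_eq_cons h, ← List.singleton_append,
    lastIdxOf_append_of_mem ((mem_edgeSides_tail h).2 ⟨hc, hc'⟩)]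
  rfl

theorem secondSide_pos {k c : ℕ} {T : List (List ℕ)} (h : IsCatalanTable k T) (hc : 1 ≤ c)
    (hc' : c ≤ k) : 1 ≤ secondSide T c := by
  rw [secondSide_eq_tail h hc hc']
  omega

theorem notMem_map_shiftFrom {c d v : ℕ} {l : List ℕ} (hv : v < c + d) (hv' : c ≤ v) :
    v ∉ l.map (shiftFrom c d) := by
  rw [List.mem_map]
  rintro ⟨w, hw, rfl⟩
  unfold shiftFrom at hv hv'
  split_ifs at hv hv' <;> omega

/-! ### Side labels of the edges of a product. -/

section Products

variable {a b : ℕ} {S T : List (List ℕ)} (hS : IsCatalanTable a S) (hT : IsCatalanTable b T)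

include hS hT

theorem diamond_sides_left {c : ℕ} (hc : 1 ≤ c) (hc' : c ≤ a) :
    firstSide (diamond S T) c = firstSide S c ∧ secondSide (diamond S T) c = secondSide S c := by
  rw [firstSide, secondSide_eq, (diamond_tree hS hT).2,
    List.idxOf_append_of_mem ((mem_edgeSides hS).2 ⟨hc, hc'⟩), lastIdxOf_append_of_notMem]
  · exact ⟨rfl, rfl⟩
  · exact notMem_map_shiftFrom (by omega) hc

theorem diamond_sides_right {c : ℕ} (hc : 1 ≤ c) (hc' : c ≤ b) :
    firstSide (diamond S T) (shiftFrom 1 a c) = firstSide T c + 2 * a ∧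
      secondSide (diamond S T) (shiftFrom 1 a c) = secondSide T c + 2 * a := by
  have h1 : shiftFrom 1 a c ∉ edgeSides S := by
    rw [mem_edgeSides hS, shiftFrom_of_le hc]
    omega
  rw [firstSide, secondSide_eq, (diamond_tree hS hT).2,
    List.idxOf_append_of_notMem h1, lastIdxOf_append_of_mem,
    idxOf_map_of_injective (shiftFrom_injective _ _), lastIdxOf_map (shiftFrom_injective _ _),
    (edgeSides_facts hS).1, add_comm, ← secondSide_eq, add_comm (2 * a)]
  · exact ⟨rfl, rfl⟩
  · exact List.mem_map.2 ⟨c, (mem_edgeSides hT).2 ⟨hc, hc'⟩, rfl⟩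

theorem spade_sides_left {c : ℕ} (hc : 1 ≤ c) (hc' : c ≤ a) :
    firstSide (spade S T) (c + 1) = firstSide S c + 1 ∧
      secondSide (spade S T) (c + 1) = secondSide S c + 1 := by
  have h1 : c + 1 = shiftFrom 1 1 c := (shiftFrom_of_le hc).symm
  have h2 : c ∈ edgeSides S := (mem_edgeSides hS).2 ⟨hc, hc'⟩
  have h3 : c + 1 ∈ (edgeSides S).map (shiftFrom 1 1) := by
    rw [h1]
    exact List.mem_map_of_mem h2
  rw [firstSide, secondSide_eq, (spade_tree hS hT).2.2.2, List.idxOf_cons_ne _ (by omega),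
    List.idxOf_append_of_mem h3, ← List.singleton_append, lastIdxOf_append_of_mem (by simp [h3]),
    lastIdxOf_append_of_notMem, h1,
    idxOf_map_of_injective (shiftFrom_injective _ _), lastIdxOf_map (shiftFrom_injective _ _)]
  · exact ⟨rfl, add_comm _ _⟩
  · exact notMem_map_shiftFrom (by omega) (by omega)

theorem spade_sides_right {c : ℕ} (hc : 1 ≤ c) (hc' : c ≤ b) :
    firstSide (spade S T) (shiftFrom 2 a c) = shiftFrom 1 (2 * a) (firstSide T c) ∧
      secondSide (spade S T) (shiftFrom 2 a c) = shiftFrom 1 (2 * a) (secondSide T c) := by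
  have h0 : c ∈ (edgeSides T).tail := (mem_edgeSides_tail hT).2 ⟨hc, hc'⟩
  have h1 : shiftFrom 2 a c ∈ (edgeSides T).tail.map (shiftFrom 2 a) := List.mem_map_of_mem h0
  constructor
  · by_cases hc1 : c = 1
    · rw [hc1, shiftFrom_of_lt (by omega), firstSide_one (hS.spade hT), firstSide_one hT]
      rfl
    · have h2 : shiftFrom 2 a c ∉ (edgeSides S).map (shiftFrom 1 1) := by
        rw [List.mem_map]
        rintro ⟨w, hw, hw'⟩
        rw [mem_edgeSides hS] at hw
        rw [shiftFrom_of_le hw.1, shiftFrom_of_le (by omega)] at hw'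
        omega
      rw [firstSide, (spade_tree hS hT).2.2.2, List.idxOf_cons_ne _, List.idxOf_append_of_notMem h2,
        idxOf_map_of_injective (shiftFrom_injective _ _), firstSide, edgeSides_eq_cons hT,
        List.idxOf_cons_ne _ (Ne.symm hc1), shiftFrom_of_le (by omega), List.length_map,
        (edgeSides_facts hS).1]
      · simp
        omega
      · rw [shiftFrom_of_le (by omega)]
        omega
  · rw [secondSide_eq, (spade_tree hS hT).2.2.2, ← List.singleton_append,
      lastIdxOf_append_of_mem (List.mem_append_right _ h1), lastIdxOf_append_of_mem h1,
      lastIdxOf_map (shiftFrom_injective _ _), secondSide_eq_tail hT hc hc',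
      shiftFrom_of_le (by omega),
      List.length_map, (edgeSides_facts hS).1]
    simp
    omega

theorem diamond_evenSide_left {c : ℕ} (hc : 1 ≤ c) (hc' : c ≤ a) :
    evenSide (diamond S T) c = evenSide S c ∧ oddSide (diamond S T) c = oddSide S c := by
  obtain ⟨h1, h2⟩ := diamond_sides_left hS hT hc hc'
  simp [evenSide, oddSide, h1, h2]

theorem diamond_evenSide_right {c : ℕ} (hc : 1 ≤ c) (hc' : c ≤ b) :
    evenSide (diamond S T) (shiftFrom 1 a c) = evenSide T c + 2 * a ∧
      oddSide (diamond S T) (shiftFrom 1 a c) = oddSide T c + 2 * a := by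
  obtain ⟨h1, h2⟩ := diamond_sides_right hS hT hc hc'
  have h3 : Even (firstSide T c + 2 * a) ↔ Even (firstSide T c) := by
    simp [Nat.even_add]
  simp only [evenSide, oddSide, h1, h2, h3]
  split_ifs <;> simp

theorem spade_evenSide_left {c : ℕ} (hc : 1 ≤ c) (hc' : c ≤ a) :
    evenSide (spade S T) (c + 1) = oddSide S c + 1 ∧
      oddSide (spade S T) (c + 1) = evenSide S c + 1 := by
  obtain ⟨h1, h2⟩ := spade_sides_left hS hT hc hc'
  simp only [evenSide, oddSide, h1, h2, Nat.even_add_one, ite_not]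
  split_ifs <;> simp

theorem spade_evenSide_right {c : ℕ} (hc : 1 ≤ c) (hc' : c ≤ b) :
    evenSide (spade S T) (shiftFrom 2 a c) = shiftFrom 1 (2 * a) (evenSide T c) ∧
      oddSide (spade S T) (shiftFrom 2 a c) = shiftFrom 1 (2 * a) (oddSide T c) := by
  obtain ⟨h1, h2⟩ := spade_sides_right hS hT hc hc'
  have h3 : Even (shiftFrom 1 (2 * a) (firstSide T c)) ↔ Even (firstSide T c) := by
    unfold shiftFrom
    split_ifs <;> simp [Nat.even_add]
  simp only [evenSide, oddSide, h1, h2, h3]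
  split_ifs <;> simp

theorem diamond_secondSide_one : secondSide (diamond S T) 1 = secondSide S 1 :=
  (diamond_sides_left hS hT le_rfl hS.pos).2

theorem spade_secondSide_one : secondSide (spade S T) 1 = secondSide T 1 + 2 * a := by
  have := (spade_sides_right hS hT le_rfl hT.pos).2
  rwa [shiftFrom_of_lt (by omega), shiftFrom_of_le (secondSide_pos hT le_rfl hT.pos)] at this

end Products

/-- The partner of `0` has the parity of `1` and `N-1`, so admissibility applies to the differences
of their energies. -/
theorem odd_secondSide_one {k : ℕ} {T : List (List ℕ)} (h : IsCatalanTable k T) :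
    secondSide T 1 % 2 = 1 := by
  refine IsCatalanTable.induction_products (P := fun k T => secondSide T 1 % 2 = 1) ?_ ?_ ?_ k T h
  · decide
  · intro a b S T hS hT hS' hT'
    rwa [diamond_secondSide_one hS hT]
  · intro a b S T hS hT hS' hT'
    rw [spade_secondSide_one hS hT]
    omega

/-! ### Levels -/

/-- The right ends are consecutive, so the entry appended for the edge `a` lands at position `a.2`.
The entry at `a.1 < a.2` is already there, and entries never change afterwards. -/
theorem foldl_levels {t : List (ℕ × ℕ)} {R : List ℕ} {n : ℕ}
    (h2 : t.map Prod.snd = List.range' R.length n) (h1 : ∀ a ∈ t, a.1 < a.2) :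
    (∀ i < R.length, (t.foldl (fun L a => L ++ [L.getD a.1 0 + 1]) R).getD i 0 = R.getD i 0) ∧
      ∀ a ∈ t, (t.foldl (fun L a => L ++ [L.getD a.1 0 + 1]) R).getD a.2 0 =
        (t.foldl (fun L a => L ++ [L.getD a.1 0 + 1]) R).getD a.1 0 + 1 := by
  induction t generalizing R n with
  | nil => simp
  | cons x t ih =>
    cases n with
    | zero => simp at h2
    | succ n =>
      rw [List.map_cons, List.range'_succ, List.cons.injEq] at h2
      obtain ⟨h0, h2⟩ := h2
      obtain ⟨ih1, ih2⟩ := ih (R := R ++ [R.getD x.1 0 + 1]) (n := n) (by simpa using h2)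
        (fun a ha => h1 a (by simp [ha]))
      rw [List.foldl_cons]
      rw [List.length_append, List.length_singleton] at ih1
      have hx := h1 x (by simp)
      refine ⟨fun i hi => ?_, fun a ha => ?_⟩
      · rw [ih1 i (by omega), List.getD_append _ _ _ _ hi]
      · rcases List.mem_cons.1 ha with rfl | ha
        · rw [ih1 a.2 (by omega), ih1 a.1 (by omega), List.getD_append_right _ _ _ a.2 (by omega),
            List.getD_append _ _ _ a.1 (by omega), h0]
          simp
        · exact ih2 a ha

theorem pocketTree_snd {k : ℕ} {T : List (List ℕ)} (h : IsCatalanTable k T) :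
    (pocketTree T).map Prod.snd = List.range' 1 k := by
  have h1 := h.2.2.length_eq
  have h2 : (lengthTuple T).length = T.length := by cases T <;> simp [lengthTuple]
  rw [pocketTree, directTree_snd h.2.2]
  have := h.2.1
  congr
  omega

theorem pocketTree_lt {k : ℕ} {T : List (List ℕ)} (h : IsCatalanTable k T) :
    ∀ a ∈ pocketTree T, a.1 < a.2 ∧ 1 ≤ a.2 ∧ a.2 ≤ k := by
  have h2 : (lengthTuple T).length = T.length := by cases T <;> simp [lengthTuple]
  intro a ha
  have := directTree_lt h.2.2 a ha
  have := h.2.1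
  omega

theorem levels_zero {k : ℕ} {T : List (List ℕ)} (h : IsCatalanTable k T) :
    (levels T).getD 0 0 = 0 :=
  (foldl_levels (R := [0]) (pocketTree_snd h) (fun a ha => (pocketTree_lt h a ha).1)).1 0 (by simp)

theorem levels_succ {k : ℕ} {T : List (List ℕ)} (h : IsCatalanTable k T) :
    ∀ a ∈ pocketTree T, (levels T).getD a.2 0 = (levels T).getD a.1 0 + 1 :=
  (foldl_levels (R := [0]) (pocketTree_snd h) (fun a ha => (pocketTree_lt h a ha).1)).2

/-- An embedding of trees that respects parents changes distances by the level of the image of the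
root. -/
theorem levels_map {a b : ℕ} {S T : List (List ℕ)} (hS : IsCatalanTable a S)
    (hT : IsCatalanTable b T) (ψ : ℕ → ℕ)
    (hψ : ∀ x ∈ pocketTree S, (ψ x.1, ψ x.2) ∈ pocketTree T) (c : ℕ) (hc : c ≤ a) :
    (levels T).getD (ψ c) 0 = (levels S).getD c 0 + (levels T).getD (ψ 0) 0 := by
  induction c using Nat.strong_induction_on with
  | _ c ih =>
  cases c with
  | zero => rw [levels_zero hS, zero_add]
  | succ c =>
    have h1 : c + 1 ∈ (pocketTree S).map Prod.snd := by
      rw [pocketTree_snd hS, List.mem_range'_1]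
      omega
    obtain ⟨x, hx, hxc⟩ := List.mem_map.1 h1
    have h2 := (pocketTree_lt hS x hx).1
    have h3 := levels_succ hT _ (hψ x hx)
    have h4 := levels_succ hS x hx
    simp only [hxc] at h3 h4
    rw [h3, h4, ih x.1 (by omega) (by omega)]
    omega

/-! ### Distances to the root in a product. -/

section Products

variable {a b : ℕ} {S T : List (List ℕ)} (hS : IsCatalanTable a S) (hT : IsCatalanTable b T)

include hS hT

theorem diamond_levels_left {c : ℕ} (hc : c ≤ a) :
    (levels (diamond S T)).getD c 0 = (levels S).getD c 0 := by
  have := levels_map hS (hS.diamond hT) id (by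
    intro x hx
    rw [(diamond_tree hS hT).1]
    exact List.mem_append_left _ hx) c hc
  simpa only [id, levels_zero (hS.diamond hT), add_zero] using this

theorem diamond_levels_right {c : ℕ} (hc : c ≤ b) :
    (levels (diamond S T)).getD (shiftFrom 1 a c) 0 = (levels T).getD c 0 := by
  have := levels_map hT (hS.diamond hT) (shiftFrom 1 a) (by
    intro x hx
    rw [(diamond_tree hS hT).1]
    exact List.mem_append_right _ (List.mem_map.2 ⟨x, hx, rfl⟩)) c hc
  rwa [shiftFrom_of_lt (v := 0) (by omega), levels_zero (hS.diamond hT), add_zero] at this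

theorem spade_levels_right {c : ℕ} (hc : c ≤ b) :
    (levels (spade S T)).getD (shiftFrom 2 a c) 0 = (levels T).getD c 0 := by
  have := levels_map hT (hS.spade hT) (shiftFrom 2 a) (by
    intro x hx
    rw [(spade_tree hS hT).2.2.1]
    rw [(spade_tree hS hT).1] at hx
    rcases List.mem_cons.1 hx with rfl | hx
    · simp [shiftFrom]
    · exact List.mem_cons_of_mem _ (List.mem_append_right _ (List.mem_map.2 ⟨x, hx, rfl⟩))) c hc
  rwa [shiftFrom_of_lt (v := 0) (by omega), levels_zero (hS.spade hT), add_zero] at this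

theorem spade_levels_left {c : ℕ} (hc : c ≤ a) :
    (levels (spade S T)).getD (c + 1) 0 = (levels S).getD c 0 + 1 := by
  have h1 := levels_map hS (hS.spade hT) (· + 1) (by
    intro x hx
    rw [(spade_tree hS hT).2.2.1]
    exact List.mem_cons_of_mem _ (List.mem_append_left _ (List.mem_map.2 ⟨x, hx, rfl⟩))) c hc
  have h2 := levels_succ (hS.spade hT) (0, 1) (by
    rw [(spade_tree hS hT).2.2.1]
    simp)
  simp only [levels_zero (hS.spade hT), zero_add] at h1 h2
  rw [h1, h2]

end Products

/-! ### Rows of nodes -/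

/-- Right end points of the edges of `t` that contain `m`. -/
def incident (t : List (ℕ × ℕ)) (m : ℕ) : List ℕ :=
  (t.filter (fun a => a.1 = m ∨ a.2 = m)).map Prod.snd

theorem incidentEdges_eq (T : List (List ℕ)) (m : ℕ) :
    incidentEdges T m = incident (pocketTree T) m := rfl

theorem incident_append (s t : List (ℕ × ℕ)) (m : ℕ) :
    incident (s ++ t) m = incident s m ++ incident t m := by
  simp [incident]

theorem incident_cons (x : ℕ × ℕ) (t : List (ℕ × ℕ)) (m : ℕ) :
    incident (x :: t) m = (if x.1 = m ∨ x.2 = m then [x.2] else []) ++ incident t m := by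
  by_cases h : x.1 = m ∨ x.2 = m <;> simp [incident, h]

theorem incident_map {ψ : ℕ → ℕ} (hψ : Function.Injective ψ) (t : List (ℕ × ℕ)) (m : ℕ) :
    incident (t.map (Prod.map ψ ψ)) (ψ m) = (incident t m).map ψ := by
  induction t with
  | nil => rfl
  | cons x t ih =>
    rw [List.map_cons, incident_cons, incident_cons, ih, List.map_append]
    simp only [Prod.map_fst, Prod.map_snd, hψ.eq_iff]
    split_ifs <;> rfl

theorem incident_eq_nil {t : List (ℕ × ℕ)} {m : ℕ} (h : ∀ a ∈ t, a.1 ≠ m ∧ a.2 ≠ m) :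
    incident t m = [] := by
  simp only [incident, List.map_eq_nil_iff, List.filter_eq_nil_iff]
  intro a ha
  have := h a ha
  simp [this.1, this.2]

theorem incident_map_eq_nil {ψ : ℕ → ℕ} {t : List (ℕ × ℕ)} {m : ℕ} (h : ∀ i, ψ i ≠ m) :
    incident (t.map (Prod.map ψ ψ)) m = [] := by
  apply incident_eq_nil
  intro a ha
  obtain ⟨b, -, rfl⟩ := List.mem_map.1 ha
  exact ⟨h _, h _⟩

theorem mem_incidentEdges {k m c : ℕ} {T : List (List ℕ)} (h : IsCatalanTable k T)
    (hc : c ∈ incidentEdges T m) : 1 ≤ c ∧ c ≤ k := by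
  simp only [incidentEdges, List.mem_map, List.mem_filter] at hc
  obtain ⟨a, ⟨ha, -⟩, rfl⟩ := hc
  exact (pocketTree_lt h a ha).2

/-- The even labels at the edges attached to `P_m`. -/
def evenRow (T : List (List ℕ)) (m : ℕ) : List ℕ := (incidentEdges T m).map (evenSide T)

/-- The odd labels at the edges attached to `P_m`. -/
def oddRow (T : List (List ℕ)) (m : ℕ) : List ℕ := (incidentEdges T m).map (oddSide T)

theorem pocketThreads_eq (T : List (List ℕ)) (m : ℕ) : pocketThreads T m =
    if Even ((levels T).getD m 0) then
      labelThreads (evenRow T m) (directTree (T.getD m [])) ++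
        labelThreads (oddRow T m) (oppositeTree (T.getD m []))
    else
      labelThreads (evenRow T m) (oppositeTree (T.getD m [])) ++
        labelThreads (oddRow T m) (directTree (T.getD m [])) := rfl

theorem IsCatalanTable.getD {k m : ℕ} {T : List (List ℕ)} (h : IsCatalanTable k T) (hm : m ≤ k) :
    IsCatalanTuple (T.getD m []) := by
  have := h.2.1
  rw [List.getD_eq_getElem _ _ (by omega)]
  exact h.1 _ (List.getElem_mem _)

theorem incidentEdges_zero {k : ℕ} {T : List (List ℕ)} (h : IsCatalanTable k T) :
    incidentEdges T 0 = 1 :: (incidentEdges T 0).tail := by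
  rw [incidentEdges_eq, (spade_tree h h).1, incident_cons]
  simp

theorem incidentEdges_one {k : ℕ} {T : List (List ℕ)} (h : IsCatalanTable k T) :
    incidentEdges T 1 = 1 :: (incidentEdges T 1).tail := by
  rw [incidentEdges_eq, (spade_tree h h).1, incident_cons]
  simp

theorem evenSide_one {k : ℕ} {T : List (List ℕ)} (h : IsCatalanTable k T) : evenSide T 1 = 0 := by
  simp [evenSide, firstSide_one h]

theorem oddSide_one {k : ℕ} {T : List (List ℕ)} (h : IsCatalanTable k T) :
    oddSide T 1 = secondSide T 1 := by
  simp [oddSide, firstSide_one h]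

/-! ### Tuples, incident edges and rows of nodes of a product. -/

section Products

variable {a b : ℕ} {S T : List (List ℕ)} (hS : IsCatalanTable a S) (hT : IsCatalanTable b T)

include hS hT

theorem diamond_getD_zero :
    (diamond S T).getD 0 [] = circ (S.getD 0 []) (T.getD 0 []) := by
  obtain ⟨e, es, rfl, -⟩ := hS.exists_cons
  obtain ⟨f, fs, rfl, -⟩ := hT.exists_cons
  rfl

omit hT in
theorem diamond_getD_left {m : ℕ} (hm : 1 ≤ m) (hm' : m ≤ a) :
    (diamond S T).getD m [] = S.getD m [] := by
  obtain ⟨e, es, rfl, -, -, rfl, -⟩ := hS.exists_cons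
  obtain ⟨n, rfl⟩ := Nat.exists_eq_add_of_le' hm
  simp only [diamond, List.getD_cons_succ, List.tail_cons]
  exact List.getD_append _ _ _ _ (by omega)

theorem diamond_getD_right {m : ℕ} (hm : 1 ≤ m) :
    (diamond S T).getD (shiftFrom 1 a m) [] = T.getD m [] := by
  obtain ⟨e, es, rfl, -, -, rfl, -⟩ := hS.exists_cons
  obtain ⟨f, fs, rfl, -⟩ := hT.exists_cons
  rw [shiftFrom_of_le hm]
  obtain ⟨n, rfl⟩ := Nat.exists_eq_add_of_le' hm
  rw [show n + 1 + es.length = (n + es.length) + 1 by omega]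
  simp only [diamond, List.getD_cons_succ, List.tail_cons]
  rw [List.getD_append_right _ _ _ _ (by omega), Nat.add_sub_cancel]

theorem spade_getD_one :
    (spade S T).getD 1 [] = bullet (T.getD 1 []) (S.getD 0 []) := by
  obtain ⟨e, es, rfl, -⟩ := hS.exists_cons
  obtain ⟨f, g, fs, rfl, -⟩ := hT.exists_cons_cons
  rfl

omit hT in
theorem spade_getD_left {m : ℕ} (hm : 1 ≤ m) (hm' : m ≤ a) :
    (spade S T).getD (m + 1) [] = S.getD m [] := by
  obtain ⟨e, es, rfl, -, -, rfl, -⟩ := hS.exists_cons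
  obtain ⟨n, rfl⟩ := Nat.exists_eq_add_of_le' hm
  simp only [spade, List.getD_cons_succ, List.tail_cons]
  exact List.getD_append _ _ _ _ (by omega)

theorem spade_getD_right {m : ℕ} (hm : m ≠ 1) :
    (spade S T).getD (shiftFrom 2 a m) [] = T.getD m [] := by
  obtain ⟨e, es, rfl, -, -, rfl, -⟩ := hS.exists_cons
  obtain ⟨f, g, fs, rfl, -⟩ := hT.exists_cons_cons
  cases m with
  | zero => rfl
  | succ m =>
    rw [shiftFrom_of_le (by omega)]
    obtain ⟨n, rfl⟩ := Nat.exists_eq_add_of_le' (show 1 ≤ m by omega)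
    rw [show n + 1 + 1 + es.length = (n + es.length) + 1 + 1 by omega]
    simp only [spade, List.getD_cons_succ, List.tail_cons]
    rw [List.getD_append_right _ _ _ _ (by omega), Nat.add_sub_cancel]

theorem diamond_incident_zero : incidentEdges (diamond S T) 0 =
    incidentEdges S 0 ++ (incidentEdges T 0).map (shiftFrom 1 a) := by
  rw [incidentEdges_eq, (diamond_tree hS hT).1, incident_append]
  have := incident_map (shiftFrom_injective 1 a) (pocketTree T) 0
  rw [shiftFrom_of_lt (by omega)] at this
  rw [this]
  rfl

theorem diamond_incident_left {m : ℕ} (hm : 1 ≤ m) (hm' : m ≤ a) :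
    incidentEdges (diamond S T) m = incidentEdges S m := by
  rw [incidentEdges_eq, (diamond_tree hS hT).1, incident_append, incident_map_eq_nil,
    List.append_nil]
  · rfl
  · intro i
    unfold shiftFrom
    split_ifs <;> omega

theorem diamond_incident_right {m : ℕ} (hm : 1 ≤ m) :
    incidentEdges (diamond S T) (shiftFrom 1 a m) = (incidentEdges T m).map (shiftFrom 1 a) := by
  rw [incidentEdges_eq, (diamond_tree hS hT).1, incident_append,
    incident_map (shiftFrom_injective 1 a), incident_eq_nil, List.nil_append]
  · rfl
  · intro x hx
    have := pocketTree_lt hS x hx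
    rw [shiftFrom_of_le hm]
    omega

theorem spade_incident_right {m : ℕ} (hm : m ≠ 1) :
    incidentEdges (spade S T) (shiftFrom 2 a m) = (incidentEdges T m).map (shiftFrom 2 a) := by
  rw [incidentEdges_eq, (spade_tree hS hT).2.2.1, incident_cons, incident_append,
    incident_map (shiftFrom_injective 2 a), incident_eq_nil, List.nil_append, incidentEdges_eq,
    (spade_tree hS hT).1, incident_cons, List.tail_cons, List.map_append]
  · congr 1
    have h1 : shiftFrom 2 a m ≠ 1 := by
      unfold shiftFrom
      split_ifs <;> omega
    have h2 : shiftFrom 2 a m = 0 ↔ m = 0 := by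
      unfold shiftFrom
      split_ifs <;> omega
    simp only [hm.symm, h1.symm, eq_comm (a := 0), h2, or_false]
    split_ifs <;> simp [shiftFrom]
  · intro x hx
    obtain ⟨y, hy, rfl⟩ := List.mem_map.1 hx
    have := pocketTree_lt hS y hy
    simp only [Prod.map_fst, Prod.map_snd]
    unfold shiftFrom
    split_ifs <;> omega

theorem spade_incident_left {m : ℕ} (hm : 1 ≤ m) (hm' : m ≤ a) :
    incidentEdges (spade S T) (m + 1) = (incidentEdges S m).map (· + 1) := by
  rw [incidentEdges_eq, (spade_tree hS hT).2.2.1, incident_cons, incident_append,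
    incident_map (add_left_injective 1), incident_map_eq_nil, List.append_nil]
  · rw [if_neg (by simp; omega), List.nil_append]
    rfl
  · intro i
    unfold shiftFrom
    split_ifs <;> omega

theorem spade_incident_one : incidentEdges (spade S T) 1 =
    1 :: ((incidentEdges S 0).map (· + 1) ++ (incidentEdges T 1).tail.map (shiftFrom 2 a)) := by
  have h1 := incident_map (add_left_injective 1) (pocketTree S) 0
  have h2 := incident_map (shiftFrom_injective 2 a) (pocketTree T).tail 1
  rw [shiftFrom_of_lt (by omega)] at h2
  simp only [zero_add] at h1
  rw [incidentEdges_eq, (spade_tree hS hT).2.2.1, incident_cons, incident_append, h1, h2,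
    incidentEdges_eq T, (spade_tree hS hT).1, incident_cons]
  simp [incidentEdges_eq]

theorem diamond_rows_zero :
    evenRow (diamond S T) 0 = evenRow S 0 ++ (evenRow T 0).map (· + 2 * a) ∧
      oddRow (diamond S T) 0 = oddRow S 0 ++ (oddRow T 0).map (· + 2 * a) := by
  simp only [evenRow, oddRow, diamond_incident_zero hS hT, List.map_append, List.map_map]
  refine ⟨congrArg₂ _ (List.map_congr_left fun c hc => ?_) (List.map_congr_left fun c hc => ?_),
    congrArg₂ _ (List.map_congr_left fun c hc => ?_) (List.map_congr_left fun c hc => ?_)⟩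
  · exact (diamond_evenSide_left hS hT (mem_incidentEdges hS hc).1 (mem_incidentEdges hS hc).2).1
  · exact (diamond_evenSide_right hS hT (mem_incidentEdges hT hc).1 (mem_incidentEdges hT hc).2).1
  · exact (diamond_evenSide_left hS hT (mem_incidentEdges hS hc).1 (mem_incidentEdges hS hc).2).2
  · exact (diamond_evenSide_right hS hT (mem_incidentEdges hT hc).1 (mem_incidentEdges hT hc).2).2

theorem diamond_rows_left {m : ℕ} (hm : 1 ≤ m) (hm' : m ≤ a) :
    evenRow (diamond S T) m = evenRow S m ∧ oddRow (diamond S T) m = oddRow S m := by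
  simp only [evenRow, oddRow, diamond_incident_left hS hT hm hm']
  refine ⟨List.map_congr_left fun c hc => ?_, List.map_congr_left fun c hc => ?_⟩
  · exact (diamond_evenSide_left hS hT (mem_incidentEdges hS hc).1 (mem_incidentEdges hS hc).2).1
  · exact (diamond_evenSide_left hS hT (mem_incidentEdges hS hc).1 (mem_incidentEdges hS hc).2).2

theorem diamond_rows_right {m : ℕ} (hm : 1 ≤ m) :
    evenRow (diamond S T) (shiftFrom 1 a m) = (evenRow T m).map (· + 2 * a) ∧
      oddRow (diamond S T) (shiftFrom 1 a m) = (oddRow T m).map (· + 2 * a) := by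
  simp only [evenRow, oddRow, diamond_incident_right hS hT hm, List.map_map]
  refine ⟨List.map_congr_left fun c hc => ?_, List.map_congr_left fun c hc => ?_⟩
  · exact (diamond_evenSide_right hS hT (mem_incidentEdges hT hc).1 (mem_incidentEdges hT hc).2).1
  · exact (diamond_evenSide_right hS hT (mem_incidentEdges hT hc).1 (mem_incidentEdges hT hc).2).2

theorem spade_rows_right {m : ℕ} (hm : m ≠ 1) :
    evenRow (spade S T) (shiftFrom 2 a m) = (evenRow T m).map (shiftFrom 1 (2 * a)) ∧
      oddRow (spade S T) (shiftFrom 2 a m) = (oddRow T m).map (shiftFrom 1 (2 * a)) := by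
  simp only [evenRow, oddRow, spade_incident_right hS hT hm, List.map_map]
  refine ⟨List.map_congr_left fun c hc => ?_, List.map_congr_left fun c hc => ?_⟩
  · exact (spade_evenSide_right hS hT (mem_incidentEdges hT hc).1 (mem_incidentEdges hT hc).2).1
  · exact (spade_evenSide_right hS hT (mem_incidentEdges hT hc).1 (mem_incidentEdges hT hc).2).2

/-- The labels of `S` move by one, which exchanges the even and the odd row. -/
theorem spade_rows_left {m : ℕ} (hm : 1 ≤ m) (hm' : m ≤ a) :
    evenRow (spade S T) (m + 1) = (oddRow S m).map (· + 1) ∧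
      oddRow (spade S T) (m + 1) = (evenRow S m).map (· + 1) := by
  simp only [evenRow, oddRow, spade_incident_left hS hT hm hm', List.map_map]
  refine ⟨List.map_congr_left fun c hc => ?_, List.map_congr_left fun c hc => ?_⟩
  · exact (spade_evenSide_left hS hT (mem_incidentEdges hS hc).1 (mem_incidentEdges hS hc).2).1
  · exact (spade_evenSide_left hS hT (mem_incidentEdges hS hc).1 (mem_incidentEdges hS hc).2).2

theorem spade_rows_one :
    (evenRow (spade S T) 1 = 0 ::
      ((oddRow S 0).map (· + 1) ++ (evenRow T 1).tail.map (shiftFrom 1 (2 * a)))) ∧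
    (oddRow (spade S T) 1 = secondSide (spade S T) 1 ::
      ((evenRow S 0).map (· + 1) ++ (oddRow T 1).tail.map (shiftFrom 1 (2 * a)))) := by
  simp only [evenRow, oddRow, spade_incident_one hS hT, List.map_append, List.map_map,
    List.map_cons, List.map_tail, ← evenSide_one (hS.spade hT), ← oddSide_one (hS.spade hT)]
  simp only [← List.map_tail]
  refine ⟨congrArg _ (congrArg₂ _ (List.map_congr_left fun c hc => ?_)
    (List.map_congr_left fun c hc => ?_)),
    congrArg _ (congrArg₂ _ (List.map_congr_left fun c hc => ?_)
    (List.map_congr_left fun c hc => ?_))⟩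
  · exact (spade_evenSide_left hS hT (mem_incidentEdges hS hc).1 (mem_incidentEdges hS hc).2).1
  · replace hc := List.mem_of_mem_tail hc
    exact (spade_evenSide_right hS hT (mem_incidentEdges hT hc).1 (mem_incidentEdges hT hc).2).1
  · exact (spade_evenSide_left hS hT (mem_incidentEdges hS hc).1 (mem_incidentEdges hS hc).2).2
  · replace hc := List.mem_of_mem_tail hc
    exact (spade_evenSide_right hS hT (mem_incidentEdges hT hc).1 (mem_incidentEdges hT hc).2).2

end Products

/-- Each row has exactly as many nodes as the trees drawn on it, so the default value in
`labelThreads` is never used for a table. -/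
theorem length_incidentEdges {k : ℕ} {T : List (List ℕ)} (h : IsCatalanTable k T) :
    ∀ m ≤ k, (incidentEdges T m).length = (T.getD m []).length := by
  refine IsCatalanTable.induction_products
    (P := fun k T => ∀ m ≤ k, (incidentEdges T m).length = (T.getD m []).length) ?_ ?_ ?_ k T h
  · decide
  · intro a b S T hS hT ihS ihT m hm
    rcases Nat.eq_zero_or_pos m with rfl | hm0
    · have := ihS 0 (by omega)
      have := ihT 0 (by omega)
      obtain ⟨x, es, he, -⟩ := (hS.getD (Nat.zero_le a)).exists_cons
      simp only [diamond_incident_zero hS hT, diamond_getD_zero hS hT, circ, he, List.length_append,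
        List.length_map, List.length_cons, List.tail_cons] at *
      omega
    · by_cases hma : m ≤ a
      · rw [diamond_incident_left hS hT hm0 hma, diamond_getD_left hS hm0 hma, ihS m hma]
      · obtain ⟨n, rfl⟩ := Nat.exists_eq_add_of_le' (show a ≤ m by omega)
        rw [← shiftFrom_of_le (c := 1) (d := a) (v := n) (by omega),
          diamond_incident_right hS hT (by omega), diamond_getD_right hS hT (by omega),
          List.length_map, ihT n (by omega)]
  · intro a b S T hS hT ihS ihT m hm
    by_cases hm1 : m = 1
    · subst hm1
      have h1 := ihS 0 (by omega)
      have h2 := ihT 1 hT.pos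
      obtain ⟨x, es, he, -⟩ := (hT.getD hT.pos).exists_cons
      rw [incidentEdges_one hT] at h2
      simp only [spade_incident_one hS hT, spade_getD_one hS hT, bullet, he, List.length_append,
        List.length_map, List.length_cons, List.tail_cons] at *
      omega
    · by_cases hma : 1 ≤ m ∧ m ≤ a + 1
      · obtain ⟨n, rfl⟩ := Nat.exists_eq_add_of_le' hma.1
        rw [spade_incident_left hS hT (by omega) (by omega),
          spade_getD_left hS (by omega) (by omega), List.length_map, ihS n (by omega)]
      · have : ∃ n ≤ b, n ≠ 1 ∧ m = shiftFrom 2 a n := by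
          by_cases hm0 : m = 0
          · exact ⟨0, by omega, by omega, hm0⟩
          · exact ⟨m - a, by omega, by omega, by rw [shiftFrom_of_le] <;> omega⟩
        obtain ⟨n, hn, hn1, rfl⟩ := this
        rw [spade_incident_right hS hT hn1, spade_getD_right hS hT hn1, List.length_map, ihT n hn]

theorem length_evenRow {k m : ℕ} {T : List (List ℕ)} (h : IsCatalanTable k T) (hm : m ≤ k) :
    (evenRow T m).length = (T.getD m []).length := by
  rw [evenRow, List.length_map, length_incidentEdges h m hm]

theorem length_oddRow {k m : ℕ} {T : List (List ℕ)} (h : IsCatalanTable k T) (hm : m ≤ k) :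
    (oddRow T m).length = (T.getD m []).length := by
  rw [oddRow, List.length_map, length_incidentEdges h m hm]

theorem evenRow_zero_getD {k : ℕ} {T : List (List ℕ)} (h : IsCatalanTable k T) :
    (evenRow T 0).getD 0 0 = 0 := by
  rw [evenRow, incidentEdges_zero h, List.map_cons, evenSide_one h]
  rfl

theorem oddRow_zero_getD {k : ℕ} {T : List (List ℕ)} (h : IsCatalanTable k T) :
    (oddRow T 0).getD 0 0 = secondSide T 1 := by
  rw [oddRow, incidentEdges_zero h, List.map_cons, oddSide_one h]
  rfl

theorem evenRow_one {k : ℕ} {T : List (List ℕ)} (h : IsCatalanTable k T) :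
    evenRow T 1 = 0 :: (evenRow T 1).tail := by
  rw [evenRow, incidentEdges_one h, List.map_cons, evenSide_one h]
  rfl

theorem oddRow_one {k : ℕ} {T : List (List ℕ)} (h : IsCatalanTable k T) :
    oddRow T 1 = secondSide T 1 :: (oddRow T 1).tail := by
  rw [oddRow, incidentEdges_one h, List.map_cons, oddSide_one h]
  rfl

/-- The last step of the walk returns to the root, so the label `N-1` closes the root's odd row.
This is the end point of the new opposite thread in both products. -/
theorem oddRow_zero_eq_append {k : ℕ} {T : List (List ℕ)} (h : IsCatalanTable k T) :
    ∃ l, oddRow T 0 = l ++ [2 * k - 1] := by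
  refine IsCatalanTable.induction_products
    (P := fun k T => ∃ l, oddRow T 0 = l ++ [2 * k - 1]) ?_ ?_ ?_ k T h
  · exact ⟨[], by decide⟩
  · rintro a b S T hS hT - ⟨l, hl⟩
    have := hT.pos
    refine ⟨oddRow S 0 ++ l.map (· + 2 * a), ?_⟩
    rw [(diamond_rows_zero hS hT).2, hl]
    simp
    omega
  · rintro a b S T hS hT - ⟨l, hl⟩
    have := hT.pos
    refine ⟨l.map (shiftFrom 1 (2 * a)), ?_⟩
    have h1 := (spade_rows_right hS hT zero_ne_one).2
    rw [shiftFrom_of_lt (by omega), hl, List.map_append, List.map_singleton,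
      shiftFrom_of_le (by omega)] at h1
    rw [h1]
    simp
    omega

theorem oddRow_zero_getD_last {k : ℕ} {T : List (List ℕ)} (h : IsCatalanTable k T) :
    (oddRow T 0).getD (T.getD 0 []).sum 0 = 2 * k - 1 := by
  obtain ⟨l, hl⟩ := oddRow_zero_eq_append h
  have h1 := length_oddRow h (Nat.zero_le k)
  have h2 := (h.getD (Nat.zero_le k)).length_eq
  rw [hl, List.length_append, List.length_singleton] at h1
  rw [hl, List.getD_append_right _ _ _ _ (by omega), show (T.getD 0 []).sum - l.length = 0 by omega]
  rfl

/-! ### Threads of products -/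

theorem labelThreads_append (R : List ℕ) (s t : List (ℕ × ℕ)) :
    labelThreads R (s ++ t) = labelThreads R s ++ labelThreads R t := by
  simp [labelThreads]

theorem labelThreads_cons (R : List ℕ) (x : ℕ × ℕ) (t : List (ℕ × ℕ)) :
    labelThreads R (x :: t) = (R.getD x.1 0, R.getD x.2 0) :: labelThreads R t := rfl

theorem labelThreads_append_left {R R' : List ℕ} {t : List (ℕ × ℕ)}
    (h : ∀ x ∈ t, x.1 < R.length ∧ x.2 < R.length) :
    labelThreads (R ++ R') t = labelThreads R t := by
  refine List.map_congr_left fun x hx => ?_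
  rw [List.getD_append _ _ _ _ (h x hx).1, List.getD_append _ _ _ _ (h x hx).2]

/-- No bound on the nodes is needed: in the applications the default `0` occurs on both sides at
once. -/
theorem labelThreads_map_nodes {R R' : List ℕ} {t : List (ℕ × ℕ)} {ψ : ℕ → ℕ}
    (h : ∀ i, R'.getD (ψ i) 0 = R.getD i 0) :
    labelThreads R' (t.map (Prod.map ψ ψ)) = labelThreads R t := by
  simp only [labelThreads, List.map_map]
  refine List.map_congr_left fun x _ => ?_
  simp only [Function.comp, Prod.map_fst, Prod.map_snd, h]

/-- Here the nodes must lie in the row, because `g` need not fix the default `0`. -/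
theorem labelThreads_map {R : List ℕ} {t : List (ℕ × ℕ)} (g : ℕ → ℕ)
    (h : ∀ x ∈ t, x.1 < R.length ∧ x.2 < R.length) :
    labelThreads (R.map g) t = (labelThreads R t).map (Prod.map g g) := by
  simp only [labelThreads, List.map_map]
  refine List.map_congr_left fun x hx => ?_
  obtain ⟨h1, h2⟩ := h x hx
  simp [h1, h2]

theorem getD_append_add (R R' : List ℕ) (i : ℕ) :
    (R ++ R').getD (i + R.length) 0 = R'.getD i 0 := by
  rw [List.getD_append_right _ _ _ _ (by omega), Nat.add_sub_cancel]

theorem getD_cons_append_shiftFrom (r : ℕ) (R R' : List ℕ) (i : ℕ) :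
    (r :: (R ++ R')).getD (shiftFrom 1 R.length i) 0 = (r :: R').getD i 0 := by
  cases i with
  | zero => rfl
  | succ i =>
    rw [shiftFrom_of_le (by omega), show i + 1 + R.length = i + R.length + 1 by omega,
      List.getD_cons_succ, List.getD_cons_succ, getD_append_add]

theorem directTree_nodes_lt {e : List ℕ} (he : IsCatalanTuple e) :
    ∀ a ∈ directTree e, a.1 < e.length ∧ a.2 < e.length := by
  intro a ha
  have := directTree_lt he a ha
  omega

theorem labelThreads_directTree_circ {e f R R' : List ℕ} (he : IsCatalanTuple e)
    (hf : IsCatalanTuple f) (hR : R.length = e.length) :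
    labelThreads (R ++ R') (directTree (circ e f)) =
      labelThreads R (directTree e) ++
        (R.getD 0 0, R'.getD 0 0) :: labelThreads R' (directTree f) := by
  have h0 : 0 < R.length := by rw [hR, he.length_eq]; omega
  rw [directTree_circ he hf, labelThreads_append, labelThreads_cons, ← hR,
    labelThreads_map_nodes (R := R') (getD_append_add R R'),
    labelThreads_append_left (by rw [hR]; exact directTree_nodes_lt he)]
  have h1 := getD_append_add R R' 0
  rw [zero_add] at h1
  simp only
  rw [h1, List.getD_append _ _ _ _ h0]

theorem labelThreads_oppositeTree_circ {e f R R' : List ℕ} (he : IsCatalanTuple e)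
    (hf : IsCatalanTuple f) (hR : R.length = e.length) :
    labelThreads (R ++ R') (oppositeTree (circ e f)) =
      labelThreads R (oppositeTree e) ++
        (labelThreads R' (oppositeTree f) ++ [(R.getD 0 0, R'.getD f.sum 0)]) := by
  have h0 : 0 < R.length := by rw [hR, he.length_eq]; omega
  rw [oppositeTree_circ he hf, labelThreads_append, labelThreads_append, labelThreads_cons, ← hR,
    labelThreads_map_nodes (R := R') (getD_append_add R R'),
    labelThreads_append_left (by rw [hR]; exact oppositeTree_lt he)]
  have h1 := getD_append_add R R' f.sum
  rw [add_comm] at h1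
  simp only
  rw [h1, List.getD_append _ _ _ _ h0]
  rfl

theorem labelThreads_directTree_bullet {r : ℕ} {e f R R' : List ℕ} (he : IsCatalanTuple e)
    (hf : IsCatalanTuple f) (hR : R.length = f.length) :
    labelThreads (r :: (R ++ R')) (directTree (bullet e f)) =
      (r, R.getD 0 0) :: (labelThreads R (directTree f) ++
        labelThreads (r :: R') (directTree e)) := by
  have h0 : 0 < R.length := by rw [hR, hf.length_eq]; omega
  rw [directTree_bullet he hf, List.cons_append, labelThreads_cons, labelThreads_append, ← hR,
    labelThreads_map_nodes (R := r :: R') (getD_cons_append_shiftFrom r R R'),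
    labelThreads_map_nodes (R := R ++ R') (fun i => List.getD_cons_succ),
    labelThreads_append_left (by rw [hR]; exact directTree_nodes_lt hf)]
  simp only [List.getD_cons_succ, List.getD_cons_zero]
  rw [List.getD_append _ _ _ _ h0]

theorem labelThreads_oppositeTree_bullet {r : ℕ} {e f R R' : List ℕ} (he : IsCatalanTuple e)
    (hf : IsCatalanTuple f) (hR : R.length = f.length) :
    labelThreads (r :: (R ++ R')) (oppositeTree (bullet e f)) =
      labelThreads R (oppositeTree f) ++ (r, R.getD f.sum 0) ::
        labelThreads (r :: R') (oppositeTree e) := by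
  have h1 := hf.length_eq
  rw [oppositeTree_bullet he hf, labelThreads_append, labelThreads_cons, ← hR,
    labelThreads_map_nodes (R := r :: R') (getD_cons_append_shiftFrom r R R'),
    labelThreads_map_nodes (R := R ++ R') (fun i => List.getD_cons_succ),
    labelThreads_append_left (by rw [hR]; exact oppositeTree_lt hf)]
  simp only [List.getD_cons_zero]
  rw [show R.length = f.sum + 1 by omega, List.getD_cons_succ,
    List.getD_append _ _ _ _ (by omega)]

/-- The chords of a table. -/
def chordList (T : List (List ℕ)) : List (ℕ × ℕ) :=
  (pocketTree T).map (fun a => (firstSide T a.2, secondSide T a.2))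

/-- The threads of a table. -/
def threadList (T : List (List ℕ)) : List (ℕ × ℕ) :=
  (List.range T.length).flatMap (pocketThreads T)

/-- Relabelling of pairs. -/
def relabel (g : ℕ → ℕ) : Multiset (ℕ × ℕ) →+ Multiset (ℕ × ℕ) :=
  Multiset.mapAddMonoidHom (Prod.map g g)

theorem relabel_coe (g : ℕ → ℕ) (l : List (ℕ × ℕ)) :
    relabel g (l : Multiset (ℕ × ℕ)) = (l.map (Prod.map g g) : List (ℕ × ℕ)) := rfl

theorem coe_flatMap_range (n : ℕ) (F : ℕ → List (ℕ × ℕ)) :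
    (((List.range n).flatMap F : List (ℕ × ℕ)) : Multiset (ℕ × ℕ)) =
      ∑ m ∈ Finset.range n, (F m : Multiset (ℕ × ℕ)) := by
  induction n with
  | zero => simp
  | succ n ih =>
    rw [List.range_succ, List.flatMap_append, ← Multiset.coe_add, ih, Finset.sum_range_succ]
    simp

theorem coe_threadList {k : ℕ} {T : List (List ℕ)} (h : IsCatalanTable k T) :
    (threadList T : Multiset (ℕ × ℕ)) =
      ∑ m ∈ Finset.range (k + 1), (pocketThreads T m : Multiset (ℕ × ℕ)) := by
  rw [threadList, h.2.1, coe_flatMap_range]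

/-! ### Threads and chords of a product. -/

section Products

variable {a b : ℕ} {S T : List (List ℕ)} (hS : IsCatalanTable a S) (hT : IsCatalanTable b T)

include hS hT

theorem diamond_pocketThreads_left {m : ℕ} (hm : 1 ≤ m) (hm' : m ≤ a) :
    pocketThreads (diamond S T) m = pocketThreads S m := by
  rw [pocketThreads_eq, pocketThreads_eq, diamond_levels_left hS hT hm',
    (diamond_rows_left hS hT hm hm').1, (diamond_rows_left hS hT hm hm').2,
    diamond_getD_left hS hm hm']

theorem diamond_pocketThreads_right {m : ℕ} (hm : 1 ≤ m) (hm' : m ≤ b) :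
    pocketThreads (diamond S T) (shiftFrom 1 a m) =
      (pocketThreads T m).map (Prod.map (· + 2 * a) (· + 2 * a)) := by
  have h1 := length_evenRow hT hm'
  have h2 := length_oddRow hT hm'
  have h3 := directTree_nodes_lt (hT.getD hm')
  have h4 := oppositeTree_lt (hT.getD hm')
  rw [pocketThreads_eq, pocketThreads_eq, diamond_levels_right hS hT hm',
    (diamond_rows_right hS hT hm).1, (diamond_rows_right hS hT hm).2,
    diamond_getD_right hS hT hm]
  split_ifs
  · rw [List.map_append, labelThreads_map _ (h1 ▸ h3), labelThreads_map _ (h2 ▸ h4)]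
  · rw [List.map_append, labelThreads_map _ (h1 ▸ h4), labelThreads_map _ (h2 ▸ h3)]

theorem spade_pocketThreads_right {m : ℕ} (hm : m ≠ 1) (hm' : m ≤ b) :
    pocketThreads (spade S T) (shiftFrom 2 a m) =
      (pocketThreads T m).map (Prod.map (shiftFrom 1 (2 * a)) (shiftFrom 1 (2 * a))) := by
  have h1 := length_evenRow hT hm'
  have h2 := length_oddRow hT hm'
  have h3 := directTree_nodes_lt (hT.getD hm')
  have h4 := oppositeTree_lt (hT.getD hm')
  rw [pocketThreads_eq, pocketThreads_eq, spade_levels_right hS hT hm',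
    (spade_rows_right hS hT hm).1, (spade_rows_right hS hT hm).2,
    spade_getD_right hS hT hm]
  split_ifs
  · rw [List.map_append, labelThreads_map _ (h1 ▸ h3), labelThreads_map _ (h2 ▸ h4)]
  · rw [List.map_append, labelThreads_map _ (h1 ▸ h4), labelThreads_map _ (h2 ▸ h3)]

/-- Both the level and the labels go up by one. The two changes of parity compensate, so each row
keeps its kind of tree. Only the order of the two rows changes, hence the multisets. -/
theorem spade_pocketThreads_left {m : ℕ} (hm : 1 ≤ m) (hm' : m ≤ a) :
    (pocketThreads (spade S T) (m + 1) : Multiset (ℕ × ℕ)) =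
      relabel (· + 1) (pocketThreads S m) := by
  have h1 := length_evenRow hS hm'
  have h2 := length_oddRow hS hm'
  have h3 := directTree_nodes_lt (hS.getD hm')
  have h4 := oppositeTree_lt (hS.getD hm')
  rw [pocketThreads_eq, pocketThreads_eq, spade_levels_left hS hT hm',
    (spade_rows_left hS hT hm hm').1, (spade_rows_left hS hT hm hm').2,
    spade_getD_left hS hm hm', relabel_coe]
  simp only [Nat.even_add_one, ite_not]
  split_ifs
  · rw [List.map_append, labelThreads_map _ (h2 ▸ h4), labelThreads_map _ (h1 ▸ h3),
      ← Multiset.coe_add, add_comm, Multiset.coe_add]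
  · rw [List.map_append, labelThreads_map _ (h2 ▸ h3), labelThreads_map _ (h1 ▸ h4),
      ← Multiset.coe_add, add_comm, Multiset.coe_add]

/-- The direct tree on the even row joins the first node of `S` to the first of `T`, labelled `0`
and `2a`. The opposite tree on the odd row joins the first node of `S` to the last of `T`, labelled
by the partner of `0` and `N-1`. -/
theorem diamond_pocketThreads_zero :
    (pocketThreads (diamond S T) 0 : Multiset (ℕ × ℕ)) =
      pocketThreads S 0 + relabel (· + 2 * a) (pocketThreads T 0) +
        {(0, 2 * a), (secondSide S 1, 2 * (a + b) - 1)} := by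
  have hb := hT.pos
  have h0 := Nat.zero_le a
  have h0' := Nat.zero_le b
  have he := hS.getD h0
  have hf := hT.getD h0'
  have hf' := hf.length_eq
  have h1 := length_evenRow hT h0'
  have h2 := length_oddRow hT h0'
  have h3 := directTree_nodes_lt hf
  have h4 := oppositeTree_lt hf
  have h5 := oddRow_zero_getD_last hT
  have h6 := evenRow_zero_getD hT
  have e1 : ((evenRow T 0).map (· + 2 * a)).getD 0 0 = 2 * a := by
    rw [List.getD_eq_getElem _ _ (by rw [List.length_map]; omega), List.getElem_map]
    rw [List.getD_eq_getElem _ _ (by omega)] at h6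
    simp [h6]
  have e2 : ((oddRow T 0).map (· + 2 * a)).getD (T.getD 0 []).sum 0 = 2 * (a + b) - 1 := by
    rw [List.getD_eq_getElem _ _ (by rw [List.length_map]; omega), List.getElem_map]
    rw [List.getD_eq_getElem _ _ (by omega)] at h5
    simp only [h5]
    omega
  rw [pocketThreads_eq, pocketThreads_eq, pocketThreads_eq, levels_zero hS, levels_zero hT,
    levels_zero (hS.diamond hT), (diamond_rows_zero hS hT).1, (diamond_rows_zero hS hT).2,
    diamond_getD_zero hS hT, relabel_coe]
  simp only [Even.zero, if_true]
  rw [labelThreads_directTree_circ he hf (length_evenRow hS h0),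
    labelThreads_oppositeTree_circ he hf (length_oddRow hS h0), e1, e2,
    evenRow_zero_getD hS, oddRow_zero_getD hS, List.map_append, labelThreads_map _ (h1 ▸ h3),
    labelThreads_map _ (h2 ▸ h4)]
  simp only [← Multiset.coe_add, ← Multiset.cons_coe, Multiset.insert_eq_cons,
    ← Multiset.singleton_add, Multiset.coe_nil, add_zero]
  abel

/-- `P_1` has odd distance, so the even row carries the opposite tree: its new thread runs from `0`
to the last odd root label of `S`, shifted from `2a-1` to `2a`. The direct tree on the odd row
reaches the first even root label of `S`, shifted from `0` to `1`. -/
theorem spade_pocketThreads_one :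
    (pocketThreads (spade S T) 1 : Multiset (ℕ × ℕ)) =
      relabel (· + 1) (pocketThreads S 0) + relabel (shiftFrom 1 (2 * a)) (pocketThreads T 1) +
        {(0, 2 * a), (secondSide (spade S T) 1, 1)} := by
  have ha := hS.pos
  have h0 := Nat.zero_le a
  have h0' := hT.pos
  have he := hS.getD h0
  have hf := hT.getD h0'
  have he' := he.length_eq
  have h1 := length_evenRow hT h0'
  have h2 := length_oddRow hT h0'
  have h3 := directTree_nodes_lt hf
  have h4 := oppositeTree_lt hf
  have i1 := length_evenRow hS h0
  have i2 := length_oddRow hS h0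
  have i3 := directTree_nodes_lt he
  have i4 := oppositeTree_lt he
  have h5 := oddRow_zero_getD_last hS
  have h6 := evenRow_zero_getD hS
  have e1 : ((evenRow S 0).map (· + 1)).getD 0 0 = 1 := by
    rw [List.getD_eq_getElem _ _ (by rw [List.length_map]; omega), List.getElem_map]
    rw [List.getD_eq_getElem _ _ (by omega)] at h6
    simp [h6]
  have e2 : ((oddRow S 0).map (· + 1)).getD (S.getD 0 []).sum 0 = 2 * a := by
    rw [List.getD_eq_getElem _ _ (by rw [List.length_map]; omega), List.getElem_map]
    rw [List.getD_eq_getElem _ _ (by omega)] at h5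
    simp only [h5]
    omega
  have l1 : (levels (spade S T)).getD 1 0 = 1 := by
    rw [← zero_add 1, spade_levels_left hS hT h0, levels_zero hS]
  have l2 : (levels T).getD 1 0 = 1 := by
    rw [← spade_levels_right hS hT h0', shiftFrom_of_lt (by omega), l1]
  have r1 : 0 :: (evenRow T 1).tail.map (shiftFrom 1 (2 * a)) =
      (evenRow T 1).map (shiftFrom 1 (2 * a)) := by
    nth_rewrite 2 [evenRow_one hT]
    simp [shiftFrom]
  have r2 : secondSide (spade S T) 1 :: (oddRow T 1).tail.map (shiftFrom 1 (2 * a)) =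
      (oddRow T 1).map (shiftFrom 1 (2 * a)) := by
    nth_rewrite 2 [oddRow_one hT]
    rw [List.map_cons, shiftFrom_of_le (secondSide_pos hT le_rfl h0'), spade_secondSide_one hS hT]
  rw [pocketThreads_eq, pocketThreads_eq, pocketThreads_eq, levels_zero hS, l1, l2,
    (spade_rows_one hS hT).1, (spade_rows_one hS hT).2,
    spade_getD_one hS hT, relabel_coe, relabel_coe]
  simp only [Even.zero, if_true, Nat.not_even_one, if_false]
  rw [labelThreads_directTree_bullet hf he (by rw [List.length_map, i1]),
    labelThreads_oppositeTree_bullet hf he (by rw [List.length_map, i2]), e1, e2, r1, r2,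
    List.map_append, List.map_append, labelThreads_map _ (i2 ▸ i4), labelThreads_map _ (h1 ▸ h4),
    labelThreads_map _ (i1 ▸ i3), labelThreads_map _ (h2 ▸ h3)]
  simp only [← Multiset.coe_add, ← Multiset.cons_coe, Multiset.insert_eq_cons,
    ← Multiset.singleton_add]
  abel

theorem diamond_threads : (threadList (diamond S T) : Multiset (ℕ × ℕ)) =
    threadList S + relabel (· + 2 * a) (threadList T) +
      {(0, 2 * a), (secondSide S 1, 2 * (a + b) - 1)} := by
  rw [coe_threadList hS, coe_threadList hT, coe_threadList (hS.diamond hT),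
    Finset.sum_range_succ', Finset.sum_range_succ', Finset.sum_range_succ', Finset.sum_range_add,
    diamond_pocketThreads_zero hS hT, map_add, map_sum]
  have e1 : ∑ m ∈ Finset.range a, (pocketThreads (diamond S T) (m + 1) : Multiset (ℕ × ℕ)) =
      ∑ m ∈ Finset.range a, (pocketThreads S (m + 1) : Multiset (ℕ × ℕ)) := by
    refine Finset.sum_congr rfl fun m hm => ?_
    rw [Finset.mem_range] at hm
    rw [diamond_pocketThreads_left hS hT (by omega) (by omega)]
  have e2 : ∑ m ∈ Finset.range b, (pocketThreads (diamond S T) (a + m + 1) : Multiset (ℕ × ℕ)) =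
      ∑ m ∈ Finset.range b, relabel (· + 2 * a) (pocketThreads T (m + 1)) := by
    refine Finset.sum_congr rfl fun m hm => ?_
    rw [Finset.mem_range] at hm
    rw [relabel_coe, ← diamond_pocketThreads_right hS hT (by omega) (by omega),
      shiftFrom_of_le (by omega), show m + 1 + a = a + m + 1 by omega]
  rw [e1, e2]
  abel

theorem spade_threads : (threadList (spade S T) : Multiset (ℕ × ℕ)) =
    relabel (· + 1) (threadList S) + relabel (shiftFrom 1 (2 * a)) (threadList T) +
      {(0, 2 * a), (secondSide (spade S T) 1, 1)} := by
  -- The pockets are split into `P_0` of `T`, the merged pocket `P_1`, the remaining `a` pockets of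
  -- `S` and the remaining `b'` pockets of `T`.
  obtain ⟨b', hb⟩ := Nat.exists_eq_add_of_le' hT.pos
  rw [coe_threadList hS, coe_threadList hT, coe_threadList (hS.spade hT)]
  subst hb
  rw [Finset.sum_range_succ' _ a, Finset.sum_range_succ' _ (b' + 1),
    Finset.sum_range_succ' _ b', show a + (b' + 1) + 1 = a + b' + 1 + 1 by omega,
    Finset.sum_range_succ', Finset.sum_range_succ', Finset.sum_range_add,
    show 0 + 1 = 1 from rfl,
    spade_pocketThreads_one hS hT, map_add, map_sum, map_add, map_add, map_sum]
  have e0 : (pocketThreads (spade S T) 0 : Multiset (ℕ × ℕ)) =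
      relabel (shiftFrom 1 (2 * a)) (pocketThreads T 0) := by
    rw [relabel_coe, ← spade_pocketThreads_right hS hT (by omega) (by omega)]
    rfl
  have e1 : ∑ m ∈ Finset.range a, (pocketThreads (spade S T) (m + 1 + 1) : Multiset (ℕ × ℕ)) =
      ∑ m ∈ Finset.range a, relabel (· + 1) (pocketThreads S (m + 1)) := by
    refine Finset.sum_congr rfl fun m hm => ?_
    rw [Finset.mem_range] at hm
    rw [spade_pocketThreads_left hS hT (by omega) (by omega)]
  have e2 : ∑ m ∈ Finset.range b', (pocketThreads (spade S T) (a + m + 1 + 1) : Multiset (ℕ × ℕ)) =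
      ∑ m ∈ Finset.range b', relabel (shiftFrom 1 (2 * a)) (pocketThreads T (m + 1 + 1)) := by
    refine Finset.sum_congr rfl fun m hm => ?_
    rw [Finset.mem_range] at hm
    rw [relabel_coe, ← spade_pocketThreads_right hS hT (by omega) (by omega),
      shiftFrom_of_le (by omega), show m + 1 + 1 + a = a + m + 1 + 1 by omega]
  rw [e0, e1, e2]
  abel

theorem diamond_chords : (chordList (diamond S T) : Multiset (ℕ × ℕ)) =
    chordList S + relabel (· + 2 * a) (chordList T) := by
  rw [relabel_coe, Multiset.coe_add]
  congr 1
  rw [chordList, (diamond_tree hS hT).1, List.map_append, chordList, chordList, List.map_map,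
    List.map_map]
  refine congrArg₂ _ (List.map_congr_left fun x hx => ?_) (List.map_congr_left fun x hx => ?_)
  · have := pocketTree_lt hS x hx
    obtain ⟨h1, h2⟩ := diamond_sides_left hS hT this.2.1 this.2.2
    rw [h1, h2]
  · have := pocketTree_lt hT x hx
    obtain ⟨h1, h2⟩ := diamond_sides_right hS hT this.2.1 this.2.2
    simp only [Function.comp, Prod.map_snd, h1, h2, Prod.map_apply]

theorem spade_chords : (chordList (spade S T) : Multiset (ℕ × ℕ)) =
    relabel (· + 1) (chordList S) + relabel (shiftFrom 1 (2 * a)) (chordList T) := by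
  have key : ∀ x ∈ pocketTree T, (firstSide (spade S T) (shiftFrom 2 a x.2),
      secondSide (spade S T) (shiftFrom 2 a x.2)) =
      Prod.map (shiftFrom 1 (2 * a)) (shiftFrom 1 (2 * a)) (firstSide T x.2, secondSide T x.2) := by
    intro x hx
    have := pocketTree_lt hT x hx
    obtain ⟨h1, h2⟩ := spade_sides_right hS hT this.2.1 this.2.2
    simp only [h1, h2, Prod.map_apply]
  obtain ⟨h1, -, h2, -⟩ := spade_tree hS hT
  rw [h1] at key
  have k0 := key (0, 1) (by simp)
  rw [relabel_coe, relabel_coe, chordList, chordList, chordList, h1, h2]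
  simp only [List.map_cons, List.map_append, List.map_map, ← Multiset.cons_coe,
    ← Multiset.coe_add, ← k0, Multiset.add_cons]
  rw [shiftFrom_of_lt (v := 1) (by omega)]
  congr 3
  · refine List.map_congr_left fun x hx => ?_
    have := pocketTree_lt hS x hx
    obtain ⟨h1, h2⟩ := spade_sides_left hS hT this.2.1 this.2.2
    simp only [Function.comp, Prod.map_snd, h1, h2, Prod.map_apply]
  · refine List.map_congr_left fun x hx => ?_
    exact key x (List.mem_cons_of_mem _ hx)

end Products

/-! ### Sums over Catalan tables -/

/-- The finite set of Catalan tables of length `k`. -/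
noncomputable def tables (k : ℕ) : Finset (List (List ℕ)) := (finite_catalanTables k).toFinset

theorem mem_tables {k : ℕ} {T : List (List ℕ)} : T ∈ tables k ↔ IsCatalanTable k T := by
  simp [tables]

theorem sum_catalanTable {M : Type*} [AddCommMonoid M] (k : ℕ) (F : List (List ℕ) → M) :
    ∑ T : CatalanTable k, F T.1 = ∑ T ∈ tables k, F T :=
  (Finset.sum_subtype (tables k) (p := IsCatalanTable k) (fun _ => mem_tables) F).symm

theorem tables_one : tables 1 = {[[0], [0]]} := by
  ext T
  rw [mem_tables, Finset.mem_singleton]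
  constructor
  · intro h
    by_cases h0 : T.headD [] = [0]
    · by_cases h1 : T.tail.headD [] = [0]
      · exact (h.eq_of_headD h0 h1).2
      · obtain ⟨a, b, S, S', hk, -, hS, hS'⟩ := h.exists_spade h1
        have := hS.pos
        have := hS'.pos
        omega
    · obtain ⟨a, b, S, S', hk, -, hS, hS'⟩ := h.exists_diamond h0
      have := hS.pos
      have := hS'.pos
      omega
  · rintro rfl
    exact isCatalanTable_cons.2 ⟨by simp [isCatalanTuple_cons, IsForest],
      by simp [isCatalanTuple_cons, IsForest], rfl, by simp [IsForest]⟩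

/-- Reindexes a sum by the factors of a product; the summand has to vanish on the tables that are
not products. Applied to `diamond` and to `spade`. -/
theorem sum_tables_of_injective {M : Type*} [AddCommMonoid M] {k : ℕ} {f : List (List ℕ) → M}
    {op : List (List ℕ) → List (List ℕ) → List (List ℕ)}
    (hop : ∀ {a b S T}, IsCatalanTable a S → IsCatalanTable b T → IsCatalanTable (a + b) (op S T))
    (hinj : ∀ {a b a' b' S T S' T'}, IsCatalanTable a S → IsCatalanTable b T →
      IsCatalanTable a' S' → IsCatalanTable b' T' → op S T = op S' T' → S = S' ∧ T = T')
    (hf : ∀ T, IsCatalanTable (k + 1) T → (¬ ∃ a b S S', k + 1 = a + b ∧ T = op S S' ∧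
      IsCatalanTable a S ∧ IsCatalanTable b S') → f T = 0) :
    ∑ T ∈ tables (k + 1), f T = ∑ l ∈ Finset.Icc 1 k,
      ∑ S ∈ tables l, ∑ S' ∈ tables (k + 1 - l), f (op S S') := by
  have h1 : ∀ l ∈ Finset.Icc 1 k, ∑ S ∈ tables l, ∑ S' ∈ tables (k + 1 - l), f (op S S') =
      ∑ x ∈ tables l ×ˢ tables (k + 1 - l), f (op x.1 x.2) :=
    fun l _ => (Finset.sum_product' _ _ (fun S S' => f (op S S'))).symm
  rw [Finset.sum_congr rfl h1, Finset.sum_sigma']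
  refine (Finset.sum_of_injOn
    (fun x : (_ : ℕ) × (List (List ℕ) × List (List ℕ)) => op x.2.1 x.2.2) ?_ ?_ ?_ fun _ _ => rfl).symm
  · rintro ⟨l, S, S'⟩ hx ⟨l', R, R'⟩ hy h
    simp only [Finset.coe_sigma, Set.mem_sigma_iff, Finset.mem_coe, Finset.mem_product,
      mem_tables] at hx hy
    obtain ⟨rfl, rfl⟩ := hinj hx.2.1 hx.2.2 hy.2.1 hy.2.2 h
    -- The summation index `l` is recovered from the number of entries of the left factor.
    have e1 := hx.2.1.2.1
    have e2 := hy.2.1.2.1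
    have : l = l' := by omega
    subst this
    rfl
  · rintro ⟨l, S, S'⟩ hx
    simp only [Finset.coe_sigma, Set.mem_sigma_iff, Finset.mem_coe, Finset.mem_product,
      mem_tables, Finset.mem_Icc] at hx ⊢
    have := hop hx.2.1 hx.2.2
    rwa [show l + (k + 1 - l) = k + 1 by omega] at this
  · intro T hT hT'
    refine hf T (mem_tables.1 hT) ?_
    rintro ⟨a, b, S, S', hk, rfl, hS, hS'⟩
    refine hT' ⟨⟨a, S, S'⟩, ?_, rfl⟩
    have := hS.pos
    have := hS'.pos
    simp only [Finset.coe_sigma, Set.mem_sigma_iff, Finset.mem_coe, Finset.mem_product,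
      mem_tables, Finset.mem_Icc]
    exact ⟨by omega, hS, by rwa [show k + 1 - a = b by omega]⟩

/-! ### The partner of the label `0` -/

/-- The root's odd row then has a single node, which is both the first (the partner of `0`) and the
last (`2k-1`). -/
theorem secondSide_one_of_getD_zero {k : ℕ} {T : List (List ℕ)} (h : IsCatalanTable k T)
    (h0 : T.getD 0 [] = [0]) : secondSide T 1 = 2 * k - 1 := by
  have := oddRow_zero_getD_last h
  rw [h0, List.sum_singleton, oddRow_zero_getD h] at this
  exact this

/-- `P_1` is then a leaf, and the two sides of its edge are passed one right after the other. -/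
theorem secondSide_one_of_getD_one {k : ℕ} {T : List (List ℕ)} (h : IsCatalanTable k T)
    (h0 : T.getD 1 [] = [0]) : secondSide T 1 = 1 := by
  revert h0
  refine IsCatalanTable.induction_products
    (P := fun k T => T.getD 1 [] = [0] → secondSide T 1 = 1) ?_ ?_ ?_ k T h
  · decide
  · intro a b S T hS hT ihS _ h1
    rw [diamond_getD_left hS le_rfl hS.pos] at h1
    rw [diamond_secondSide_one hS hT, ihS h1]
  · intro a b S T hS hT _ _ h1
    rw [spade_getD_one hS hT] at h1
    have h2 := (hT.getD hT.pos).sum_bullet (f := S.getD 0 [])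
    rw [h1] at h2
    simp at h2

theorem IsCatalanTable.exists_diamond' {k : ℕ} {T : List (List ℕ)} (h : IsCatalanTable k T)
    (h0 : secondSide T 1 ≠ 2 * k - 1) : ∃ a b S S', k = a + b ∧ T = QuarticModel.diamond S S' ∧
      IsCatalanTable a S ∧ IsCatalanTable b S' := by
  refine h.exists_diamond fun h1 => h0 (secondSide_one_of_getD_zero h ?_)
  obtain ⟨e, es, rfl, -⟩ := h.exists_cons
  exact h1

theorem IsCatalanTable.exists_spade' {k : ℕ} {T : List (List ℕ)} (h : IsCatalanTable k T)
    (h0 : secondSide T 1 ≠ 1) : ∃ a b S S', k = a + b ∧ T = QuarticModel.spade S S' ∧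
      IsCatalanTable a S ∧ IsCatalanTable b S' := by
  refine h.exists_spade fun h1 => h0 (secondSide_one_of_getD_one h ?_)
  obtain ⟨e, f, es, rfl, -⟩ := h.exists_cons_cons
  exact h1

/-! ### Monomials of products -/

section Monomials

variable {ι K : Type*} [Field K] (E : ι → K) (G₂ : ι → ι → K)

/-- The monomial of a table, computed from its multisets of chords and threads. -/
def weight (p : ℕ → ι) (T : List (List ℕ)) : K :=
  ((chordList T : Multiset (ℕ × ℕ)).map (fun c => G₂ (p c.1) (p c.2))).prod *
    ((threadList T : Multiset (ℕ × ℕ)).map (fun t => 1 / (E (p t.1) - E (p t.2)))).prod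

theorem monomial_eq (p : ℕ → ι) {k : ℕ} (T : CatalanTable k) :
    T.monomial E G₂ p = weight E G₂ p T.1 := by
  simp only [weight, Multiset.map_coe, Multiset.prod_coe]
  rfl

theorem map_relabel {M : Type*} (g : ℕ → ℕ) (C : Multiset (ℕ × ℕ)) (F : ℕ × ℕ → M) :
    (relabel g C).map F = C.map (fun c => F (g c.1, g c.2)) := by
  simp [relabel, Multiset.map_map, Prod.map]

theorem weight_one (p : ℕ → ι) : weight E G₂ p [[0], [0]] = G₂ (p 0) (p 1) := by
  have h1 : chordList [[0], [0]] = [(0, 1)] := by decide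
  have h2 : threadList [[0], [0]] = [] := by decide
  simp [weight, h1, h2]

theorem weight_diamond (p : ℕ → ι) {a b : ℕ} {S T : List (List ℕ)} (hS : IsCatalanTable a S)
    (hT : IsCatalanTable b T) :
    weight E G₂ p (diamond S T) = weight E G₂ p S * weight E G₂ (fun i => p (i + 2 * a)) T /
      ((E (p 0) - E (p (2 * a))) * (E (p (secondSide S 1)) - E (p (2 * (a + b) - 1)))) := by
  simp only [weight]
  rw [diamond_chords hS hT, diamond_threads hS hT]
  simp only [Multiset.map_add, Multiset.prod_add, map_relabel, Multiset.insert_eq_cons,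
    Multiset.map_cons, Multiset.map_singleton, Multiset.prod_cons, Multiset.prod_singleton]
  simp only [div_eq_mul_inv, mul_inv]
  ring

theorem weight_spade (p : ℕ → ι) {a b : ℕ} {S T : List (List ℕ)} (hS : IsCatalanTable a S)
    (hT : IsCatalanTable b T) :
    weight E G₂ p (spade S T) = weight E G₂ (fun i => p (i + 1)) S *
      weight E G₂ (fun i => p (shiftFrom 1 (2 * a) i)) T /
      ((E (p 0) - E (p (2 * a))) * (E (p (secondSide (spade S T) 1)) - E (p 1))) := by
  simp only [weight]
  rw [spade_chords hS hT, spade_threads hS hT]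
  simp only [Multiset.map_add, Multiset.prod_add, map_relabel, Multiset.insert_eq_cons,
    Multiset.map_cons, Multiset.map_singleton, Multiset.prod_cons, Multiset.prod_singleton]
  simp only [div_eq_mul_inv, mul_inv]
  ring

/-- The sum of all monomials of length `k`. -/
noncomputable def totalWeight (k : ℕ) (p : ℕ → ι) : K := ∑ T ∈ tables k, weight E G₂ p T

theorem sum_monomial (k : ℕ) (p : ℕ → ι) :
    ∑ T : CatalanTable k, T.monomial E G₂ p = totalWeight E G₂ k p := by
  simp only [monomial_eq]
  exact sum_catalanTable k (weight E G₂ p)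

theorem totalWeight_one (p : ℕ → ι) : totalWeight E G₂ 1 p = G₂ (p 0) (p 1) := by
  rw [totalWeight, tables_one, Finset.sum_singleton, weight_one]

/-- The analytic core: the full sum is written as a difference of two weighted sums, one running
over `diamond` products and the other over `spade` products. A table that is a product in both ways
contributes to both. -/
theorem totalWeight_eq {k : ℕ} (hk : 1 ≤ k) {p : ℕ → ι} (hp : EnergiesDistinct E p (2 * k + 2)) :
    totalWeight E G₂ (k + 1) p = ∑ l ∈ Finset.Icc 1 k,
      (totalWeight E G₂ l p * totalWeight E G₂ (k + 1 - l) (fun i => p (i + 2 * l)) -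
        totalWeight E G₂ l (fun i => p (i + 1)) *
          totalWeight E G₂ (k + 1 - l) (fun i => p (shiftFrom 1 (2 * l) i))) /
        ((E (p 0) - E (p (2 * l))) * (E (p 1) - E (p (2 * k + 1)))) := by
  have hD : E (p 1) - E (p (2 * k + 1)) ≠ 0 :=
    sub_ne_zero.2 (hp 1 (by omega) (2 * k + 1) (by omega) (by omega) (by omega))
  -- The weight contains `E_j - E_{2k+1}`, with `j` the partner of `0`. It vanishes for `j = 2k+1`,
  -- the only possible value for tables without a `diamond` decomposition.
  have h1 := sum_tables_of_injective (k := k) (op := diamond)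
    (f := fun T => weight E G₂ p T * (E (p (secondSide T 1)) - E (p (2 * k + 1))) /
      (E (p 1) - E (p (2 * k + 1)))) IsCatalanTable.diamond diamond_inj (by
      intro T hT hT'
      have : secondSide T 1 = 2 * (k + 1) - 1 := by
        by_contra h
        exact hT' (hT.exists_diamond' h)
      rw [this]
      simp [mul_add])
  have h2 := sum_tables_of_injective (k := k) (op := spade)
    (f := fun T => weight E G₂ p T * (E (p (secondSide T 1)) - E (p 1)) /
      (E (p 1) - E (p (2 * k + 1)))) IsCatalanTable.spade spade_inj (by
      intro T hT hT'
      have : secondSide T 1 = 1 := by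
        by_contra h
        exact hT' (hT.exists_spade' h)
      rw [this]
      simp)
  -- Uses `(E_j - E_{2k+1}) - (E_j - E_1) = E_1 - E_{2k+1}` for each table separately.
  have h3 : totalWeight E G₂ (k + 1) p =
      ∑ T ∈ tables (k + 1), weight E G₂ p T * (E (p (secondSide T 1)) - E (p (2 * k + 1))) /
        (E (p 1) - E (p (2 * k + 1))) -
      ∑ T ∈ tables (k + 1), weight E G₂ p T * (E (p (secondSide T 1)) - E (p 1)) /
        (E (p 1) - E (p (2 * k + 1))) := by
    rw [totalWeight, ← Finset.sum_sub_distrib]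
    refine Finset.sum_congr rfl fun T _ => ?_
    field_simp
    ring
  rw [h3, h1, h2, ← Finset.sum_sub_distrib]
  refine Finset.sum_congr rfl fun l hl => ?_
  rw [Finset.mem_Icc] at hl
  rw [sub_div]
  congr 1
  · rw [totalWeight, totalWeight, Finset.sum_mul_sum, Finset.sum_div]
    refine Finset.sum_congr rfl fun S hS => ?_
    rw [Finset.sum_div]
    refine Finset.sum_congr rfl fun T hT => ?_
    rw [mem_tables] at hS hT
    -- The partner of `0` is odd and smaller than `2l`, hence different from `2k+1`; this allows the
    -- cancellation against the new thread.
    have hj := secondSide_lt hS le_rfl hS.pos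
    have hj' := odd_secondSide_one hS
    have hne : E (p (secondSide S 1)) - E (p (2 * k + 1)) ≠ 0 :=
      sub_ne_zero.2 (hp _ (by omega) (2 * k + 1) (by omega) (by omega) (by omega))
    rw [weight_diamond E G₂ p hS hT, diamond_secondSide_one hS hT,
      show 2 * (l + (k + 1 - l)) - 1 = 2 * k + 1 by omega]
    have h0 : E (p 0) - E (p (2 * l)) ≠ 0 :=
      sub_ne_zero.2 (hp _ (by omega) (2 * l) (by omega) (by omega) (by omega))
    field_simp
  · rw [totalWeight, totalWeight, Finset.sum_mul_sum, Finset.sum_div]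
    refine Finset.sum_congr rfl fun S hS => ?_
    rw [Finset.sum_div]
    refine Finset.sum_congr rfl fun T hT => ?_
    rw [mem_tables] at hS hT
    -- In the `spade` product the partner of `0` is that of `T` shifted by `2l`. It is odd, below
    -- `2k+2` and different from `1`.
    have hj := secondSide_lt hT le_rfl hT.pos
    have hj' := odd_secondSide_one hT
    have hne : E (p (secondSide (spade S T) 1)) - E (p 1) ≠ 0 := by
      rw [spade_secondSide_one hS hT]
      exact sub_ne_zero.2 (hp _ (by omega) 1 (by omega) (by omega) (by omega))
    rw [weight_spade E G₂ p hS hT]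
    have h0 : E (p 0) - E (p (2 * l)) ≠ 0 :=
      sub_ne_zero.2 (hp _ (by omega) (2 * l) (by omega) (by omega) (by omega))
    field_simp

/-! ### Words and the recurrence. -/

omit [Field K] in
theorem EnergiesDistinct.comp {E : ι → K} {p : ℕ → ι} {n N : ℕ} (hp : EnergiesDistinct E p N)
    {g : ℕ → ℕ} (h1 : Function.Injective g) (h2 : ∀ i < n, g i < N)
    (h3 : ∀ i j, i % 2 = j % 2 → g i % 2 = g j % 2) : EnergiesDistinct E (fun i => p (g i)) n :=
  fun i hi j hj hij hne => hp _ (h2 i hi) _ (h2 j hj) (h3 i j hij) (h1.ne hne)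

theorem word_add (p : ℕ → ι) (m n : ℕ) : word p m (n + m) = word (fun i => p (i + m)) 0 n := by
  have h := List.Ico.map_add 0 n m
  rw [zero_add, add_comm n] at h
  rw [word, word, add_comm n, ← h, List.map_map]
  refine List.map_congr_left fun i _ => ?_
  simp [add_comm]

/-- The word `p_0 p_{m+1} p_{m+2} …` of the recurrence is the relabelling `shiftFrom 1 m` of the
right factor of a `spade` product. -/
theorem cons_word (p : ℕ → ι) (m n : ℕ) :
    p 0 :: word p (m + 1) (n + (m + 1)) = word (fun i => p (shiftFrom 1 m i)) 0 (n + 1) := by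
  rw [word_add, word, word, List.Ico.eq_cons (Nat.succ_pos n), List.map_cons]
  have h := List.Ico.map_add 0 n 1
  rw [zero_add] at h
  rw [zero_add, ← h, List.map_map]
  refine congrArg₂ _ rfl (List.map_congr_left fun i _ => ?_)
  simp only [Function.comp]
  rw [shiftFrom_of_le (by omega)]
  congr 1
  omega

/-- If shorter words are given by Catalan tables, then the right-hand side of the recurrence is the
sum over all Catalan tables. -/
theorem recurrence_eq_totalWeight {E : ι → K} {G : List ι → K} {k : ℕ} (hk : 1 ≤ k)
    (H : ∀ n < k, ∀ q : ℕ → ι, EnergiesDistinct E q (2 * n + 2) →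
      G (word q 0 (2 * n + 2)) = totalWeight E (fun a b => G [a, b]) (n + 1) q)
    {p : ℕ → ι} (hp : EnergiesDistinct E p (2 * k + 2)) :
    ∑ l ∈ Finset.Icc 1 k,
        (G (word p 0 (2 * l)) * G (word p (2 * l) (2 * k + 2)) -
            G (word p 1 (2 * l + 1)) * G (p 0 :: word p (2 * l + 1) (2 * k + 2))) /
          ((E (p 0) - E (p (2 * l))) * (E (p 1) - E (p (2 * k + 1)))) =
      totalWeight E (fun a b => G [a, b]) (k + 1) p := by
  rw [totalWeight_eq E _ hk hp]
  refine Finset.sum_congr rfl fun l hl => ?_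
  rw [Finset.mem_Icc] at hl
  have e0 : EnergiesDistinct E p (2 * (l - 1) + 2) := by
    refine hp.comp (g := id) Function.injective_id (fun i hi => ?_) (fun i j h => h)
    simp only [id]
    omega
  have e1 : EnergiesDistinct E (fun i => p (i + 2 * l)) (2 * (k - l) + 2) := by
    refine hp.comp (add_left_injective _) (fun i hi => ?_) (fun i j h => ?_)
    · omega
    · omega
  have e2 : EnergiesDistinct E (fun i => p (i + 1)) (2 * (l - 1) + 2) := by
    refine hp.comp (add_left_injective _) (fun i hi => ?_) (fun i j h => ?_)
    · omega
    · omega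
  have e3 : EnergiesDistinct E (fun i => p (shiftFrom 1 (2 * l) i)) (2 * (k - l) + 2) := by
    refine hp.comp (shiftFrom_injective _ _) (fun i hi => ?_) (fun i j h => ?_)
    · unfold shiftFrom
      split_ifs <;> omega
    · unfold shiftFrom
      split_ifs <;> omega
  have h0 := H (l - 1) (by omega) _ e0
  have h1 := H (k - l) (by omega) _ e1
  have h2 := H (l - 1) (by omega) _ e2
  have h3 := H (k - l) (by omega) _ e3
  rw [← word_add, show 2 * (k - l) + 2 + 2 * l = 2 * k + 2 by omega,
    show k - l + 1 = k + 1 - l by omega] at h1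
  rw [← word_add, show 2 * (l - 1) + 2 = 2 * l by omega, Nat.sub_add_cancel hl.1] at h2
  rw [show 2 * (k - l) + 2 = 2 * (k - l) + 1 + 1 by omega, ← cons_word,
    show 2 * (k - l) + 1 + (2 * l + 1) = 2 * k + 2 by omega,
    show k - l + 1 = k + 1 - l by omega] at h3
  rw [show 2 * (l - 1) + 2 = 2 * l by omega, Nat.sub_add_cancel hl.1] at h0
  rw [h0, h1, h2, h3]

/-- Both directions use `recurrence_eq_totalWeight`. For words of length two the formula is a
tautology, since the monomials are built from `G` on such words. -/
theorem satisfiesRecurrence_iff (E : ι → K) (G : List ι → K) :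
    SatisfiesRecurrence E G ↔ ∀ (k : ℕ) (p : ℕ → ι), EnergiesDistinct E p (2 * k + 2) →
      G (word p 0 (2 * k + 2)) = totalWeight E (fun a b => G [a, b]) (k + 1) p := by
  constructor
  · intro hG k
    induction k using Nat.strong_induction_on with
    | _ k ih =>
    intro p hp
    rcases Nat.eq_zero_or_pos k with rfl | hk
    · rw [totalWeight_one]
      rfl
    · rw [hG k p hk hp, recurrence_eq_totalWeight hk ih hp]
  · intro H k p hk hp
    rw [H k p hp, recurrence_eq_totalWeight hk (fun n _ => H n) hp]

end Monomials

/-! ### Reconstruction of a table from its monomial -/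

/-- The threads of a table without their orientation. -/
def unorientedThreads (T : List (List ℕ)) : Multiset (Sym2 ℕ) :=
  (threadList T : Multiset (ℕ × ℕ)).map (fun t => s(t.1, t.2))

theorem map_relabel_sym2 (g : ℕ → ℕ) (C : Multiset (ℕ × ℕ)) :
    (relabel g C).map (fun t => s(t.1, t.2)) =
      (C.map (fun t => s(t.1, t.2))).map (Sym2.map g) := by
  rw [map_relabel, Multiset.map_map]
  rfl

/-- The new thread is written with the partner of `0` in the product, which the chords determine. It
can then be cancelled when two products are compared. -/
theorem unorientedThreads_diamond {a b : ℕ} {S T : List (List ℕ)} (hS : IsCatalanTable a S)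
    (hT : IsCatalanTable b T) : unorientedThreads (diamond S T) =
      unorientedThreads S + (unorientedThreads T).map (Sym2.map (· + 2 * a)) +
        {s(0, 2 * a), s(secondSide (diamond S T) 1, 2 * (a + b) - 1)} := by
  rw [unorientedThreads, diamond_threads hS hT, Multiset.map_add, Multiset.map_add,
    map_relabel_sym2, diamond_secondSide_one hS hT]
  rfl

theorem unorientedThreads_spade {a b : ℕ} {S T : List (List ℕ)} (hS : IsCatalanTable a S)
    (hT : IsCatalanTable b T) : unorientedThreads (spade S T) =
      (unorientedThreads S).map (Sym2.map (· + 1)) +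
        (unorientedThreads T).map (Sym2.map (shiftFrom 1 (2 * a))) +
        {s(0, 2 * a), s(secondSide (spade S T) 1, 1)} := by
  rw [unorientedThreads, spade_threads hS hT, Multiset.map_add, Multiset.map_add,
    map_relabel_sym2, map_relabel_sym2]
  rfl

theorem unorientedThreads_lt {k : ℕ} {T : List (List ℕ)} (h : IsCatalanTable k T) :
    ∀ z ∈ unorientedThreads T, ∀ x ∈ z, x < 2 * k := by
  refine IsCatalanTable.induction_products
    (P := fun k T => ∀ z ∈ unorientedThreads T, ∀ x ∈ z, x < 2 * k) ?_ ?_ ?_ k T h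
  · have h2 : threadList [[0], [0]] = [] := by decide
    simp [unorientedThreads, h2]
  · intro a b S T hS hT ihS ihT z hz x hx
    have ha := hS.pos
    have hb := hT.pos
    have hj := secondSide_lt (hS.diamond hT) le_rfl (hS.diamond hT).pos
    rw [unorientedThreads_diamond hS hT] at hz
    simp only [Multiset.mem_add, Multiset.mem_map, Multiset.insert_eq_cons, Multiset.mem_cons,
      Multiset.mem_singleton] at hz
    rcases hz with (hz | ⟨w, hw, rfl⟩) | rfl | rfl
    · have := ihS z hz x hx
      omega
    · obtain ⟨y, hy, rfl⟩ := Sym2.mem_map.1 hx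
      have := ihT w hw y hy
      omega
    · rcases Sym2.mem_iff.1 hx with rfl | rfl <;> omega
    · rcases Sym2.mem_iff.1 hx with rfl | rfl <;> omega
  · intro a b S T hS hT ihS ihT z hz x hx
    have ha := hS.pos
    have hb := hT.pos
    have hj := secondSide_lt (hS.spade hT) le_rfl (hS.spade hT).pos
    rw [unorientedThreads_spade hS hT] at hz
    simp only [Multiset.mem_add, Multiset.mem_map, Multiset.insert_eq_cons, Multiset.mem_cons,
      Multiset.mem_singleton] at hz
    rcases hz with (⟨w, hw, rfl⟩ | ⟨w, hw, rfl⟩) | rfl | rfl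
    · obtain ⟨y, hy, rfl⟩ := Sym2.mem_map.1 hx
      have := ihS w hw y hy
      omega
    · obtain ⟨y, hy, rfl⟩ := Sym2.mem_map.1 hx
      have := ihT w hw y hy
      unfold shiftFrom
      split_ifs <;> omega
    · rcases Sym2.mem_iff.1 hx with rfl | rfl <;> omega
    · rcases Sym2.mem_iff.1 hx with rfl | rfl <;> omega

theorem chordList_lt {k : ℕ} {T : List (List ℕ)} (h : IsCatalanTable k T) :
    ∀ c ∈ chordList T, c.1 < 2 * k := by
  intro c hc
  obtain ⟨x, hx, rfl⟩ := List.mem_map.1 hc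
  have := pocketTree_lt h x hx
  exact firstSide_lt h this.2.1 this.2.2

theorem zero_mem_chordList {k : ℕ} {T : List (List ℕ)} (h : IsCatalanTable k T) (x : ℕ) :
    (0, x) ∈ chordList T ↔ x = secondSide T 1 := by
  constructor
  · intro hx
    obtain ⟨a, ha, hax⟩ := List.mem_map.1 hx
    rw [Prod.mk.injEq] at hax
    rw [← hax.2, firstSide_eq_zero h hax.1]
  · rintro rfl
    refine List.mem_map.2 ⟨(0, 1), ?_, by rw [firstSide_one h]⟩
    rw [(spade_tree h h).1]
    simp

theorem secondSide_one_eq {k k' : ℕ} {T T' : List (List ℕ)} (h : IsCatalanTable k T)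
    (h' : IsCatalanTable k' T')
    (hc : (chordList T : Multiset (ℕ × ℕ)) = (chordList T' : Multiset (ℕ × ℕ))) :
    secondSide T 1 = secondSide T' 1 := by
  rw [← zero_mem_chordList h', ← Multiset.mem_coe, ← hc, Multiset.mem_coe, zero_mem_chordList h]

theorem add_eq_add_of_separated {α : Type*} {A B A' B' : Multiset α} (P : α → Prop)
    (hA : ∀ x ∈ A, P x) (hA' : ∀ x ∈ A', P x) (hB : ∀ x ∈ B, ¬ P x) (hB' : ∀ x ∈ B', ¬ P x)
    (h : A + B = A' + B') : A = A' ∧ B = B' := by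
  classical
  have h1 := congrArg (Multiset.filter P) h
  rw [Multiset.filter_add, Multiset.filter_add, Multiset.filter_eq_self.2 hA,
    Multiset.filter_eq_self.2 hA', Multiset.filter_eq_nil.2 hB, Multiset.filter_eq_nil.2 hB',
    add_zero, add_zero] at h1
  subst h1
  exact ⟨rfl, add_left_cancel h⟩

theorem mem_relabel {g : ℕ → ℕ} {C : Multiset (ℕ × ℕ)} {c : ℕ × ℕ} :
    c ∈ relabel g C ↔ ∃ d ∈ C, Prod.map g g d = c :=
  Multiset.mem_map

theorem relabel_injective {g : ℕ → ℕ} (hg : Function.Injective g) :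
    Function.Injective (relabel g) :=
  Multiset.map_injective (hg.prodMap hg)

/-! ### Locating the cut between the factors. -/

section Products

variable {a b : ℕ} {S T : List (List ℕ)} (hS : IsCatalanTable a S) (hT : IsCatalanTable b T)

include hS hT

/-- Threads of `S` stay below `2a`, those of `T` avoid `0`, and the second new thread avoids `0`. So
the cut is the largest such `c`. -/
theorem le_of_mem_unorientedThreads_diamond {c : ℕ}
    (h : s(0, 2 * c) ∈ unorientedThreads (diamond S T)) : c ≤ a := by
  have ha := hS.pos
  have hj := secondSide_pos (hS.diamond hT) le_rfl (hS.diamond hT).pos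
  rw [unorientedThreads_diamond hS hT] at h
  simp only [Multiset.mem_add, Multiset.mem_map, Multiset.insert_eq_cons, Multiset.mem_cons,
    Multiset.mem_singleton] at h
  rcases h with (h | ⟨w, -, h⟩) | h | h
  · have := unorientedThreads_lt hS _ h (2 * c) (by simp)
    omega
  · have h0 : 0 ∈ Sym2.map (· + 2 * a) w := by
      rw [h]
      simp
    obtain ⟨y, -, hy⟩ := Sym2.mem_map.1 h0
    omega
  · rw [Sym2.eq_iff] at h
    omega
  · rw [Sym2.eq_iff] at h
    omega

/-- Threads of `S` now avoid `0`, and a nonzero label inherited from `T` exceeds `2a`. So the cut is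
the smallest such `c`. -/
theorem le_of_mem_unorientedThreads_spade {c : ℕ} (hc : 1 ≤ c)
    (h : s(0, 2 * c) ∈ unorientedThreads (spade S T)) : a ≤ c := by
  have hj := secondSide_pos (hS.spade hT) le_rfl (hS.spade hT).pos
  rw [unorientedThreads_spade hS hT] at h
  simp only [Multiset.mem_add, Multiset.mem_map, Multiset.insert_eq_cons, Multiset.mem_cons,
    Multiset.mem_singleton] at h
  rcases h with (⟨w, -, h⟩ | ⟨w, -, h⟩) | h | h
  · have h0 : 0 ∈ Sym2.map (· + 1) w := by
      rw [h]
      simp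
    obtain ⟨y, -, hy⟩ := Sym2.mem_map.1 h0
    omega
  · have h0 : 2 * c ∈ Sym2.map (shiftFrom 1 (2 * a)) w := by
      rw [h]
      simp
    obtain ⟨y, -, hy⟩ := Sym2.mem_map.1 h0
    unfold shiftFrom at hy
    split_ifs at hy <;> omega
  · rw [Sym2.eq_iff] at h
    omega
  · rw [Sym2.eq_iff] at h
    omega

theorem mem_unorientedThreads_diamond :
    s(0, 2 * a) ∈ unorientedThreads (diamond S T) := by
  rw [unorientedThreads_diamond hS hT]
  simp

theorem mem_unorientedThreads_spade :
    s(0, 2 * a) ∈ unorientedThreads (spade S T) := by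
  rw [unorientedThreads_spade hS hT]
  simp

end Products

/-- The labels of the left factor are those below `2a`. After the two new threads are cancelled, a
filter on labels separates the factors. -/
theorem diamond_separate {a b : ℕ} {S T S' T' : List (List ℕ)} (hS : IsCatalanTable a S)
    (hT : IsCatalanTable b T) (hS' : IsCatalanTable a S') (hT' : IsCatalanTable b T')
    (hc : (chordList (diamond S T) : Multiset (ℕ × ℕ)) = chordList (diamond S' T'))
    (ht : unorientedThreads (diamond S T) = unorientedThreads (diamond S' T')) :
    ((chordList S : Multiset (ℕ × ℕ)) = chordList S' ∧
        unorientedThreads S = unorientedThreads S') ∧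
      ((chordList T : Multiset (ℕ × ℕ)) = chordList T' ∧
        unorientedThreads T = unorientedThreads T') := by
  have hj := secondSide_one_eq (hS.diamond hT) (hS'.diamond hT') hc
  rw [unorientedThreads_diamond hS hT, unorientedThreads_diamond hS' hT', hj] at ht
  rw [diamond_chords hS hT, diamond_chords hS' hT'] at hc
  have hR : ∀ C : List (ℕ × ℕ), ∀ c ∈ relabel (· + 2 * a) C, ¬ c.1 < 2 * a := by
    intro C c hc
    obtain ⟨d, -, rfl⟩ := mem_relabel.1 hc
    simp
  have hR' : ∀ C : Multiset (Sym2 ℕ), ∀ z ∈ C.map (Sym2.map (· + 2 * a)),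
      ¬ ∀ x ∈ z, x < 2 * a := by
    intro C z hz hz'
    obtain ⟨w, -, rfl⟩ := Multiset.mem_map.1 hz
    induction w with
    | _ u v =>
      have := hz' (u + 2 * a) (by simp)
      omega
  obtain ⟨h1, h2⟩ := add_eq_add_of_separated (fun c : ℕ × ℕ => c.1 < 2 * a)
    (chordList_lt hS) (chordList_lt hS') (hR _) (hR _) hc
  obtain ⟨h3, h4⟩ := add_eq_add_of_separated (fun z : Sym2 ℕ => ∀ x ∈ z, x < 2 * a)
    (unorientedThreads_lt hS) (unorientedThreads_lt hS') (hR' _) (hR' _) (add_right_cancel ht)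
  exact ⟨⟨h1, h3⟩, relabel_injective (add_left_injective _) h2,
    Multiset.map_injective (Sym2.map.injective (add_left_injective _)) h4⟩

/-- As for `diamond`, but the labels of the left factor are those between `1` and `2a`. -/
theorem spade_separate {a b : ℕ} {S T S' T' : List (List ℕ)} (hS : IsCatalanTable a S)
    (hT : IsCatalanTable b T) (hS' : IsCatalanTable a S') (hT' : IsCatalanTable b T')
    (hc : (chordList (spade S T) : Multiset (ℕ × ℕ)) = chordList (spade S' T'))
    (ht : unorientedThreads (spade S T) = unorientedThreads (spade S' T')) :
    ((chordList S : Multiset (ℕ × ℕ)) = chordList S' ∧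
        unorientedThreads S = unorientedThreads S') ∧
      ((chordList T : Multiset (ℕ × ℕ)) = chordList T' ∧
        unorientedThreads T = unorientedThreads T') := by
  have hj := secondSide_one_eq (hS.spade hT) (hS'.spade hT') hc
  rw [unorientedThreads_spade hS hT, unorientedThreads_spade hS' hT', hj] at ht
  rw [spade_chords hS hT, spade_chords hS' hT'] at hc
  have hs : ∀ x, ¬ (1 ≤ shiftFrom 1 (2 * a) x ∧ shiftFrom 1 (2 * a) x ≤ 2 * a) := by
    intro x
    unfold shiftFrom
    split_ifs <;> omega
  have hL : ∀ {S : List (List ℕ)}, IsCatalanTable a S → ∀ c ∈ relabel (· + 1) (chordList S),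
      1 ≤ c.1 ∧ c.1 ≤ 2 * a := by
    intro S hS c hc
    obtain ⟨d, hd, rfl⟩ := mem_relabel.1 hc
    have := chordList_lt hS d hd
    simp only [Prod.map_fst]
    omega
  have hL' : ∀ {S : List (List ℕ)}, IsCatalanTable a S →
      ∀ z ∈ (unorientedThreads S).map (Sym2.map (· + 1)), ∀ x ∈ z, 1 ≤ x ∧ x ≤ 2 * a := by
    intro S hS z hz x hx
    obtain ⟨w, hw, rfl⟩ := Multiset.mem_map.1 hz
    obtain ⟨y, hy, rfl⟩ := Sym2.mem_map.1 hx
    have := unorientedThreads_lt hS w hw y hy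
    omega
  have hR : ∀ C : List (ℕ × ℕ), ∀ c ∈ relabel (shiftFrom 1 (2 * a)) C,
      ¬ (1 ≤ c.1 ∧ c.1 ≤ 2 * a) := by
    intro C c hc
    obtain ⟨d, -, rfl⟩ := mem_relabel.1 hc
    exact hs _
  have hR' : ∀ C : Multiset (Sym2 ℕ), ∀ z ∈ C.map (Sym2.map (shiftFrom 1 (2 * a))),
      ¬ ∀ x ∈ z, 1 ≤ x ∧ x ≤ 2 * a := by
    intro C z hz hz'
    obtain ⟨w, -, rfl⟩ := Multiset.mem_map.1 hz
    induction w with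
    | _ u v => exact hs u (hz' _ (by simp))
  obtain ⟨h1, h2⟩ := add_eq_add_of_separated (fun c : ℕ × ℕ => 1 ≤ c.1 ∧ c.1 ≤ 2 * a)
    (hL hS) (hL hS') (hR _) (hR _) hc
  obtain ⟨h3, h4⟩ := add_eq_add_of_separated
    (fun z : Sym2 ℕ => ∀ x ∈ z, 1 ≤ x ∧ x ≤ 2 * a)
    (hL' hS) (hL' hS') (hR' _) (hR' _) (add_right_cancel ht)
  exact ⟨⟨relabel_injective (add_left_injective _) h1,
      Multiset.map_injective (Sym2.map.injective (add_left_injective _)) h3⟩,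
    relabel_injective (shiftFrom_injective _ _) h2,
    Multiset.map_injective (Sym2.map.injective (shiftFrom_injective _ _)) h4⟩

theorem eq_of_chords_of_threads {k : ℕ} {T T' : List (List ℕ)} (h : IsCatalanTable k T)
    (h' : IsCatalanTable k T') (hc : (chordList T : Multiset (ℕ × ℕ)) = chordList T')
    (ht : unorientedThreads T = unorientedThreads T') : T = T' := by
  induction k using Nat.strong_induction_on generalizing T T' with
  | _ k ih =>
  have hj := secondSide_one_eq h h' hc
  -- The partner of `0` is the same for both tables, so both are decomposed in the same way. It
  -- equals `1` and `2k-1` at once only for `k = 1`.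
  by_cases h0 : secondSide T 1 = 2 * k - 1
  · by_cases h1 : secondSide T 1 = 1
    · have hk := h.pos
      have : k = 1 := by omega
      subst this
      have e := mem_tables.2 h
      have e' := mem_tables.2 h'
      rw [tables_one, Finset.mem_singleton] at e e'
      rw [e, e']
    · obtain ⟨a, b, S, R, rfl, rfl, hS, hR⟩ := h.exists_spade' h1
      obtain ⟨a', b', S', R', hab, rfl, hS', hR'⟩ := h'.exists_spade' (hj ▸ h1)
      -- The cut of each table occurs as a thread in the other; minimality in both directions gives
      -- `a = a'`.
      have e1 := le_of_mem_unorientedThreads_spade hS hR hS'.pos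
        (ht ▸ mem_unorientedThreads_spade hS' hR')
      have e2 := le_of_mem_unorientedThreads_spade hS' hR' hS.pos
        (ht ▸ mem_unorientedThreads_spade hS hR)
      obtain rfl : a = a' := by omega
      obtain rfl : b = b' := by omega
      obtain ⟨h2, h3⟩ := spade_separate hS hR hS' hR' hc ht
      have := hS.pos
      have := hR.pos
      rw [ih a (by omega) hS hS' h2.1 h2.2, ih b (by omega) hR hR' h3.1 h3.2]
  · obtain ⟨a, b, S, R, rfl, rfl, hS, hR⟩ := h.exists_diamond' h0
    obtain ⟨a', b', S', R', hab, rfl, hS', hR'⟩ := h'.exists_diamond' (hj ▸ h0)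
    have e1 := le_of_mem_unorientedThreads_diamond hS hR
      (ht ▸ mem_unorientedThreads_diamond hS' hR')
    have e2 := le_of_mem_unorientedThreads_diamond hS' hR'
      (ht ▸ mem_unorientedThreads_diamond hS hR)
    obtain rfl : a = a' := by omega
    obtain rfl : b = b' := by omega
    obtain ⟨h2, h3⟩ := diamond_separate hS hR hS' hR' hc ht
    have := hS.pos
    have := hR.pos
    rw [ih a (by omega) hS hS' h2.1 h2.2, ih b (by omega) hR hR' h3.1 h3.2]

end QuarticModel

/-- A family `G` satisfies the recurrence if and only if it is given by its 2-point functions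
through the sum over Catalan tables; and different Catalan tables of the same length give different
monomials, even if the orientation of the threads (that is, the sign) is disregarded. -/
theorem theorem4p4 {ι K : Type*} [Field K] (E : ι → K) (G : List ι → K) :
    (QuarticModel.SatisfiesRecurrence E G ↔
      ∀ (k : ℕ) (p : ℕ → ι), QuarticModel.EnergiesDistinct E p (2 * k + 2) →
        G (QuarticModel.word p 0 (2 * k + 2)) =
          ∑ T : QuarticModel.CatalanTable (k + 1), T.monomial E (fun a b => G [a, b]) p) ∧
    (∀ (k : ℕ) (T T' : QuarticModel.CatalanTable (k + 1)),
      (T.chords : Multiset (ℕ × ℕ)) = (T'.chords : Multiset (ℕ × ℕ)) →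
      ((T.threads.map (fun t => s(t.1, t.2)) : List (Sym2 ℕ)) : Multiset (Sym2 ℕ)) =
        ((T'.threads.map (fun t => s(t.1, t.2)) : List (Sym2 ℕ)) : Multiset (Sym2 ℕ)) →
      T = T') := by
  refine ⟨?_, fun k T T' hc ht =>
    Subtype.ext (QuarticModel.eq_of_chords_of_threads T.2 T'.2 hc ht)⟩
  simp only [QuarticModel.sum_monomial]
  exact QuarticModel.satisfiesRecurrence_iff E G
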